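/- Let $k$ be an algebraically closed field of characteristic zero and let $A=A_1(k)=k\langle x,y\rangle/(xy-yx-1)$ be the first Weyl algebra. A (unital, right) $A_\infty$-module over $A$ is a $\mathbb Z$-graded $k$-vector space $K=\bigoplus_p K^p$ with linear maps $m_n:K\otimes A^{\otimes(n-1)}\to K$ of degree $2-n$ $(n\ge1)$ such that for all $n\ge 1$ $$\sum_{i=1}^{n-2}(-1)^{n-i}m_{n-1}(u,a_1,\dots,a_ia_{i+1},\dots,a_{n-1})+\sum_{j=1}^{n}(-1)^{n-j}m_{n-j+1}(m_j(u,a_1,\dots,a_{j-1}),a_j,\dots,a_{n-1})=0,$$ $m_2(u,1)=u$, and $m_n(u,\dots,1,\dots)=0$ for $n\ge3$. A morphism $f:K\to L$ of $A_\infty$-modules is a sequence of linear maps $f_n:K\otimes A^{\otimes(n-1)}\to L$ of degree $1-n$ such that for all $n\ge1$ $$\sum_{i=1}^{n-2}(-1)^{n-i}f_{n-1}(u,a_1,\dots,a_ia_{i+1},\dots,a_{n-1})+\sum_{j=1}^{n}(-1)^{n-j}f_{n-j+1}(m_j(u,a_1,\dots,a_{j-1}),a_j,\dots,a_{n-1})=\sum_{j=1}^{n}m_{n-j+1}(f_j(u,a_1,\dots,a_{j-1}),a_j,\dots,a_{n-1}).$$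 Composition is $(g\circ f)_n(u,a_1,\dots,a_{n-1})=\sum_{j=1}^n g_{n-j+1}(f_j(u,a_1,\dots,a_{j-1}),a_j,\dots,a_{n-1})$. The identity morphism has first component the identity map and all other components zero. A morphism $f$ is strict if $f_n=0$ for all $n\ge2$, it is an isomorphism if it has a two-sided inverse morphism, and it is a quasi-isomorphism if $f_1$ induces isomorphisms on the cohomology (with respect to $m_1$) in every degree. A right $A$-module $M$ is regarded as an $A_\infty$-module in degree $0$ with $m_2$ the action of $A$ and $m_n=0$ for $n\ne2$. Let $M$ be a finitely generated torsion-free right $A$-module of rank $1$. An $A_\infty$-envelope of $M$ is a quasi-isomorphism $r:M\to K$ of $A_\infty$-modules, where $K=K^0\oplus K^1$ is concentrated in degrees $0$ and $1$ (with $K^1=0$ allowed), such that $\dim_kK^1<\infty$ and there is $i\in K^0$ with the following properties: the map $A\to K^0$, $a\mapsto m_2(i,a)$, is bijective, and for all $v\in K^1$ and $a\in A$ we have $m_3(v,x,a)=0$, $m_3(v,a,y)=0$ and $m_3(v,y,x)\in k\,i$. Let $r:M\to K$ and $\tilde r:M\to\tilde K$ be two $A_\infty$-envelopes of $M$. Then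 there is a unique strict isomorphism of $A_\infty$-modules $f:K\to\tilde K$ such that $\tilde r=f\circ r$. Thus an $A_\infty$-envelope of $M$ is determined uniquely up to unique strict isomorphism. -/

import Mathlib

universe u v w w' w''

/-! ## The first Weyl algebra -/

/-- The defining relation `x y = y x + 1` (with `x = ι 0`, `y = ι 1`). -/
inductive WeylRel (k : Type u) [Field k] :
    FreeAlgebra k (Fin 2) → FreeAlgebra k (Fin 2) → Prop
  | comm : WeylRel k (FreeAlgebra.ι k 0 * FreeAlgebra.ι k 1)
      (FreeAlgebra.ι k 1 * FreeAlgebra.ι k 0 + 1)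

/-- The first Weyl algebra `A₁(k) = k⟨x, y⟩ / (x y - y x - 1)`. -/
abbrev WeylAlgebra (k : Type u) [Field k] : Type u := RingQuot (WeylRel k)

namespace WeylAlgebra

/-- The canonical generator `x`. -/
noncomputable def x (k : Type u) [Field k] : WeylAlgebra k :=
  RingQuot.mkAlgHom k (WeylRel k) (FreeAlgebra.ι k 0)

/-- The canonical generator `y`. -/
noncomputable def y (k : Type u) [Field k] : WeylAlgebra k :=
  RingQuot.mkAlgHom k (WeylRel k) (FreeAlgebra.ι k 1)

end WeylAlgebra

/-! ## Sequences of arguments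

A word `a₁, a₂, …, a_N` in `A` is written as (the first `N` terms of) a sequence `a : ℕ → A`, with
indices starting at `0`. -/

namespace AInf

open Finset

/-- The sequence without its first `p` terms. -/
def shift {A : Type v} (p : ℕ) (a : ℕ → A) : ℕ → A := fun i => a (p + i)

/-- `(a₀, …, aᵢ₋₁, aᵢ aᵢ₊₁, aᵢ₊₂, …)`. -/
def contract {A : Type v} [Mul A] (i : ℕ) (a : ℕ → A) : ℕ → A := fun j =>
  if j < i then a j else if j = i then a i * a (i + 1) else a (j + 1)

section
variable {k : Type u} {A : Type v} {K : Type w} {L : Type w'} [CommRing k] [Ring A] [Algebra k A]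
  [AddCommGroup K] [Module k K] [AddCommGroup L] [Module k L]

/-- Value of a multilinear operation `K ⊗ A^{⊗ n} → L` at `x` and the first `n` terms of `a`. -/
def ev {n : ℕ} (φ : K →ₗ[k] MultilinearMap k (fun _ : Fin n => A) L) (x : K) (a : ℕ → A) : L :=
  φ x (fun i => a i)

end

end AInf

/-! ## A∞-modules -/

open AInf Finset in
/-- A unital right A∞-module over an associative `k`-algebra `A`, with underlying vector space `K`.
The operation `m n : K ⊗ A^{⊗ n} → K` has `n` arguments from `A`; it is the operation that is
usually called `m_{n+1}`, so its degree is `2 - (n + 1) = 1 - n`. -/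
structure AInfModule (k : Type u) (A : Type v) (K : Type w) [Field k] [Ring A] [Algebra k A]
    [AddCommGroup K] [Module k K] where
  /-- The homogeneous components `K^p`. -/
  deg : ℤ → Submodule k K
  /-- `K = ⨁ K^p`. -/
  isInternal : DirectSum.IsInternal deg
  /-- The structure maps. -/
  m (n : ℕ) : K →ₗ[k] MultilinearMap k (fun _ : Fin n => A) K
  m_mem (n : ℕ) (p : ℤ) (x : K) (hx : x ∈ deg p) (a : Fin n → A) : m n x a ∈ deg (p + 1 - n)
  /-- The strong homotopy relations
  `∑ᵢ ± m_{N}(x, a₁, …, aᵢ aᵢ₊₁, …, a_N) + ∑ⱼ ± m_{N-j+2}(m_j(x, a₁, …, a_{j-1}), a_j, …, a_N) = 0`,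
  in which the sign is `-1` to the number of letters to the right of the place where the inner
  operation acts. -/
  rel (N : ℕ) (x : K) (a : ℕ → A) :
    ∑ i ∈ range (N - 1), (-1 : k) ^ (N - i) • ev (m (N - 1)) x (contract i a) +
      ∑ pq ∈ antidiagonal N, (-1 : k) ^ pq.2 • ev (m pq.2) (ev (m pq.1) x a) (shift pq.1 a) = 0
  /-- Unitality: `m₂(x, 1) = x`. -/
  m_one (x : K) : m 1 x (fun _ => 1) = x
  /-- Unitality: the higher operations vanish if one of the arguments from `A` is `1`. -/
  m_unit (n : ℕ) (hn : 2 ≤ n) (x : K) (a : Fin n → A) (i : Fin n) (hi : a i = 1) : m n x a = 0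

open AInf Finset in
/-- A morphism `K → L` of A∞-modules over `A`. The component `f n : K ⊗ A^{⊗ n} → L` has `n`
arguments from `A`; it is the component that is usually called `f_{n+1}`, so its degree is
`1 - (n + 1) = - n`. -/
structure AInfHom {k : Type u} {A : Type v} {K : Type w} {L : Type w'} [Field k] [Ring A]
    [Algebra k A] [AddCommGroup K] [Module k K] [AddCommGroup L] [Module k L]
    (S : AInfModule k A K) (T : AInfModule k A L) where
  /-- The components. -/
  f (n : ℕ) : K →ₗ[k] MultilinearMap k (fun _ : Fin n => A) L
  f_mem (n : ℕ) (p : ℤ) (x : K) (hx : x ∈ S.deg p) (a : Fin n → A) : f n x a ∈ T.deg (p - n)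
  /-- The homotopy relations
  `∑ᵢ ± f_{N}(x, a₁, …, aᵢ aᵢ₊₁, …, a_N) + ∑ⱼ ± f_{N-j+2}(m_j(x, a₁, …, a_{j-1}), a_j, …, a_N)
    = ∑ⱼ m_{N-j+2}(f_j(x, a₁, …, a_{j-1}), a_j, …, a_N)`, with the same signs as for modules. -/
  rel (N : ℕ) (x : K) (a : ℕ → A) :
    ∑ i ∈ range (N - 1), (-1 : k) ^ (N - i) • ev (f (N - 1)) x (contract i a) +
      ∑ pq ∈ antidiagonal N, (-1 : k) ^ pq.2 • ev (f pq.2) (ev (S.m pq.1) x a) (shift pq.1 a) =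
      ∑ pq ∈ antidiagonal N, ev (T.m pq.2) (ev (f pq.1) x a) (shift pq.1 a)

namespace AInfHom

open AInf Finset

theorem shift_shift {A : Type v} (p q : ℕ) (a : ℕ → A) : shift p (shift q a) = shift (q + p) a := by
  funext i; simp [shift, add_assoc]

section Comp

variable {k : Type u} {A : Type v} {K : Type w} {L : Type w'} {P : Type w''} [Field k] [Ring A]
  [Algebra k A] [AddCommGroup K] [Module k K] [AddCommGroup L] [Module k L]
  [AddCommGroup P] [Module k P]

/-- The operation `(x, a₁, …, a_N) ↦ ψ(φ(x, a₁, …, a_p), a_{p+1}, …, a_N)`, where `N = p + q`. -/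
def plug {p q N : ℕ} (h : p + q = N) (ψ : L →ₗ[k] MultilinearMap k (fun _ : Fin q => A) P)
    (φ : K →ₗ[k] MultilinearMap k (fun _ : Fin p => A) L) :
    K →ₗ[k] MultilinearMap k (fun _ : Fin N => A) P where
  toFun x := ((ψ.compMultilinearMap (φ x)).uncurrySum).domDomCongr
    (finSumFinEquiv.trans (finCongr h))
  map_add' x y := by ext a; simp [MultilinearMap.uncurrySum_apply]
  map_smul' c x := by ext a; simp [MultilinearMap.uncurrySum_apply]

theorem plug_apply {p q N : ℕ} (h : p + q = N)
    (ψ : L →ₗ[k] MultilinearMap k (fun _ : Fin q => A) P)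
    (φ : K →ₗ[k] MultilinearMap k (fun _ : Fin p => A) L) (x : K) (a : Fin N → A) :
    plug h ψ φ x a = ψ (φ x (fun i => a ⟨i, by omega⟩)) (fun i => a ⟨p + i, by omega⟩) := by
  subst h
  rfl

theorem ev_plug {p q N : ℕ} (h : p + q = N)
    (ψ : L →ₗ[k] MultilinearMap k (fun _ : Fin q => A) P)
    (φ : K →ₗ[k] MultilinearMap k (fun _ : Fin p => A) L) (x : K) (a : ℕ → A) :
    ev (plug h ψ φ) x a = ev ψ (ev φ x a) (shift p a) := by
  simp only [ev, plug_apply]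
  rfl

/-- The components of the composition of two morphisms. -/
def compFun {S : AInfModule k A K} {T : AInfModule k A L} {U : AInfModule k A P}
    (g : AInfHom T U) (f : AInfHom S T) (N : ℕ) :
    K →ₗ[k] MultilinearMap k (fun _ : Fin N => A) P :=
  ∑ p : Fin (N + 1), plug (by omega : (p : ℕ) + (N - p) = N) (g.f (N - p)) (f.f p)

theorem ev_compFun {S : AInfModule k A K} {T : AInfModule k A L} {U : AInfModule k A P}
    (g : AInfHom T U) (f : AInfHom S T) (N : ℕ) (x : K) (a : ℕ → A) :
    ev (compFun g f N) x a =
      ∑ pq ∈ antidiagonal N, ev (g.f pq.2) (ev (f.f pq.1) x a) (shift pq.1 a) := by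
  rw [Finset.Nat.sum_antidiagonal_eq_sum_range_succ_mk, Finset.sum_range]
  simp only [ev, compFun, LinearMap.sum_apply, _root_.sum_apply]
  exact sum_congr rfl fun p _ => ev_plug (by omega) _ _ x a

theorem ev_congr {n : ℕ} (φ : K →ₗ[k] MultilinearMap k (fun _ : Fin n => A) L) (x : K)
    {a b : ℕ → A} (h : ∀ i < n, a i = b i) : ev φ x a = ev φ x b := by
  simp only [ev]; congr 1; funext i; exact h i i.2

theorem shift_contract_lt {i p : ℕ} (h : i < p) (a : ℕ → A) :
    shift p (contract i a) = shift (p + 1) a := by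
  funext j
  simp only [shift, contract]
  rw [if_neg (by omega), if_neg (by omega)]
  congr 1; omega

theorem shift_contract_ge {i p : ℕ} (a : ℕ → A) :
    shift p (contract (p + i) a) = contract i (shift p a) := by
  funext j
  simp only [shift, contract]
  split_ifs <;> first | omega | rfl

theorem ev_zero {n : ℕ} (φ : K →ₗ[k] MultilinearMap k (fun _ : Fin n => A) L) (a : ℕ → A) :
    ev φ 0 a = 0 := by simp [ev]
theorem ev_add {n : ℕ} (φ : K →ₗ[k] MultilinearMap k (fun _ : Fin n => A) L) (x y : K)
    (a : ℕ → A) : ev φ (x + y) a = ev φ x a + ev φ y a := by simp [ev]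
theorem ev_smul {n : ℕ} (φ : K →ₗ[k] MultilinearMap k (fun _ : Fin n => A) L) (c : k) (x : K)
    (a : ℕ → A) : ev φ (c • x) a = c • ev φ x a := by simp [ev]
theorem ev_sum {ι : Type*} (s : Finset ι) {n : ℕ}
    (φ : K →ₗ[k] MultilinearMap k (fun _ : Fin n => A) L) (x : ι → K)
    (a : ℕ → A) : ev φ (∑ i ∈ s, x i) a = ∑ i ∈ s, ev φ (x i) a := by
  simp [ev, _root_.sum_apply]

theorem sum_triple {M : Type*} [AddCommMonoid M] (N : ℕ) (F : ℕ → ℕ → ℕ → ℕ → M) :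
    ∑ pq ∈ antidiagonal N, ∑ rs ∈ antidiagonal pq.1, F pq.1 rs.1 rs.2 pq.2 =
      ∑ pq ∈ antidiagonal N, ∑ rs ∈ antidiagonal pq.2, F (pq.1 + rs.1) pq.1 rs.1 rs.2 := by
  rw [sum_sigma', sum_sigma']
  refine sum_nbij' (fun z => ⟨(z.2.1, z.2.2 + z.1.2), (z.2.2, z.1.2)⟩)
    (fun z => ⟨(z.1.1 + z.2.1, z.2.2), (z.1.1, z.2.1)⟩) ?_ ?_ ?_ ?_ ?_ <;>
  · rintro ⟨⟨p, q⟩, ⟨r, s⟩⟩ h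
    simp only [mem_sigma, HasAntidiagonal.mem_antidiagonal] at h ⊢
    obtain ⟨h1, h2⟩ := h
    subst h2
    first | rfl | exact ⟨by omega, trivial⟩

/-- The terms of the composition relation in which two letters are multiplied, sorted by whether
both letters are arguments of the inner or of the outer morphism. -/
theorem sum_contract {S : AInfModule k A K} {T : AInfModule k A L} {U : AInfModule k A P}
    (g : AInfHom T U) (f : AInfHom S T) (N : ℕ) (x : K) (a : ℕ → A) :
    ∑ i ∈ range (N - 1), (-1 : k) ^ (N - i) • ev (compFun g f (N - 1)) x (contract i a) =
      ∑ pq ∈ antidiagonal N, (-1 : k) ^ pq.2 • ev (g.f pq.2)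
        (∑ i ∈ range (pq.1 - 1), (-1 : k) ^ (pq.1 - i) • ev (f.f (pq.1 - 1)) x (contract i a))
        (shift pq.1 a) +
      ∑ pq ∈ antidiagonal N, ∑ i ∈ range (pq.2 - 1), (-1 : k) ^ (pq.2 - i) •
        ev (g.f (pq.2 - 1)) (ev (f.f pq.1) x a) (contract i (shift pq.1 a)) := by
  cases N with
  | zero => simp [ev_zero]
  | succ n =>
    rw [Finset.Nat.sum_antidiagonal_succ, Finset.Nat.sum_antidiagonal_succ']
    simp only [Nat.add_sub_cancel, ev_compFun, smul_sum, Nat.zero_sub, range_zero, sum_empty,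
      ev_zero, smul_zero, zero_add, ev_sum, ev_smul, smul_smul]
    rw [sum_comm, ← sum_add_distrib]
    refine sum_congr rfl ?_
    rintro ⟨p, q⟩ hpq
    rw [HasAntidiagonal.mem_antidiagonal] at hpq
    dsimp only at hpq ⊢
    subst hpq
    rw [sum_range_add]
    congr 1
    · refine sum_congr rfl fun i hi => ?_
      rw [mem_range] at hi
      rw [shift_contract_lt hi, ← pow_add]
      congr 2
      omega
    · refine sum_congr rfl fun i hi => ?_
      rw [shift_contract_ge, ev_congr (f.f p) x (a := contract (p + i) a) (b := a)]
      · congr 2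
        omega
      · intro j hj
        simp only [contract]
        rw [if_pos (by omega)]

/-- Composition of morphisms of A∞-modules:
`(g ∘ f)_N(x, a₁, …) = ∑ⱼ g_{N-j+1}(f_j(x, a₁, …, a_{j-1}), a_j, …)`. -/
def comp {S : AInfModule k A K} {T : AInfModule k A L} {U : AInfModule k A P}
    (g : AInfHom T U) (f : AInfHom S T) : AInfHom S U where
  f := compFun g f
  f_mem N p x hx a := by
    simp only [compFun, LinearMap.sum_apply, _root_.sum_apply]
    refine Submodule.sum_mem _ fun i _ => ?_
    rw [plug_apply]
    have := g.f_mem (N - i) _ _ (f.f_mem i p x hx fun j => a ⟨j, by omega⟩)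
      (fun j => a ⟨i + j, by omega⟩)
    have h : p - (i : ℕ) - ((N - (i : ℕ) : ℕ) : ℤ) = p - N := by omega
    rwa [h] at this
  rel N x a := by
    rw [sum_contract]
    have hf : ∀ p, ∑ i ∈ range (p - 1), (-1 : k) ^ (p - i) • ev (f.f (p - 1)) x (contract i a) =
        ∑ rs ∈ antidiagonal p, ev (T.m rs.2) (ev (f.f rs.1) x a) (shift rs.1 a) +
        ∑ rs ∈ antidiagonal p, (-1 : k) • (-1 : k) ^ rs.2 •
          ev (f.f rs.2) (ev (S.m rs.1) x a) (shift rs.1 a) := fun p => by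
      rw [← f.rel p x a, ← smul_sum]; simp
    have hg : ∀ (q : ℕ) (y : L) (b : ℕ → A),
        ∑ i ∈ range (q - 1), (-1 : k) ^ (q - i) • ev (g.f (q - 1)) y (contract i b) =
        ∑ rs ∈ antidiagonal q, ev (U.m rs.2) (ev (g.f rs.1) y b) (shift rs.1 b) +
        ∑ rs ∈ antidiagonal q, (-1 : k) • (-1 : k) ^ rs.2 •
          ev (g.f rs.2) (ev (T.m rs.1) y b) (shift rs.1 b) := fun q y b => by
      rw [← g.rel q y b, ← smul_sum]; simp
    simp only [hf, hg, ev_compFun, ev_add, ev_sum, ev_smul, smul_add, smul_sum, sum_add_distrib,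
      shift_shift]
    rw [sum_triple N fun p r s q => (-1 : k) ^ q •
        ev (g.f q) (ev (T.m s) (ev (f.f r) x a) (shift r a)) (shift p a),
      sum_triple N fun p r s q => (-1 : k) ^ q • (-1 : k) • (-1 : k) ^ s •
        ev (g.f q) (ev (f.f s) (ev (S.m r) x a) (shift r a)) (shift p a),
      sum_triple N fun p r s q =>
        ev (U.m q) (ev (g.f s) (ev (f.f r) x a) (shift r a)) (shift p a)]
    simp only [← sum_add_distrib]
    refine sum_congr rfl fun pq _ => sum_congr rfl fun rs hrs => ?_
    rw [HasAntidiagonal.mem_antidiagonal] at hrs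
    rw [← hrs]
    simp only [smul_smul, pow_add]
    module

/-- The components of the identity morphism: the identity map, and zero. -/
def idFun (k : Type u) (A : Type v) (K : Type w) [Field k] [Ring A] [Algebra k A]
    [AddCommGroup K] [Module k K] : (n : ℕ) → K →ₗ[k] MultilinearMap k (fun _ : Fin n => A) K
  | 0 => (MultilinearMap.constLinearEquivOfIsEmpty (R := k) (S := k)
      (M₁ := fun _ : Fin 0 => A) (M₂ := K)).toLinearMap
  | _ + 1 => 0

theorem ev_idFun (n : ℕ) (x : K) (a : ℕ → A) :
    ev (idFun k A K n) x a = if n = 0 then x else 0 := by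
  cases n <;> simp [ev, idFun]

/-- The identity morphism, which is strict. -/
def id (S : AInfModule k A K) : AInfHom S S where
  f := idFun k A K
  f_mem n p x hx a := by
    cases n with
    | zero => simpa [idFun] using hx
    | succ n => simp [idFun]
  rel N x a := by
    rw [sum_eq_zero, sum_eq_single (N, 0), sum_eq_single (0, N)]
    · have : shift 0 a = a := by funext i; simp [shift]
      simp [ev_idFun, this]
    · rintro ⟨p, q⟩ h hne
      rw [HasAntidiagonal.mem_antidiagonal] at h
      rw [ev_idFun, if_neg, ev_zero]
      rintro rfl
      exact hne (by simp at h; rw [h])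
    · simp
    · rintro ⟨p, q⟩ h hne
      rw [HasAntidiagonal.mem_antidiagonal] at h
      rw [ev_idFun, if_neg, smul_zero]
      rintro rfl
      exact hne (by simp at h; rw [h])
    · simp
    · intro i hi
      rw [mem_range] at hi
      rw [ev_idFun, if_neg (by omega), smul_zero]

/-- A morphism is strict if all its components but the first one vanish. -/
def IsStrict {S : AInfModule k A K} {T : AInfModule k A L} (f : AInfHom S T) : Prop :=
  ∀ n, 1 ≤ n → f.f n = 0

/-- Isomorphisms in the category of A∞-modules and (not necessarily strict) morphisms. -/
def IsIso {S : AInfModule k A K} {T : AInfModule k A L} (f : AInfHom S T) : Prop :=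
  ∃ g : AInfHom T S, g.comp f = AInfHom.id S ∧ f.comp g = AInfHom.id T

end Comp
end AInfHom

/-! ## Cohomology and quasi-isomorphisms -/

section Cohomology

variable {k : Type u} {A : Type v} {K : Type w} {L : Type w'} [Field k] [Ring A] [Algebra k A]
  [AddCommGroup K] [Module k K] [AddCommGroup L] [Module k L]

namespace AInfModule

/-- The differential `m₁ : K → K`. -/
def d (S : AInfModule k A K) : K →ₗ[k] K :=
  (MultilinearMap.constLinearEquivOfIsEmpty (R := k) (S := k)
    (M₁ := fun _ : Fin 0 => A) (M₂ := K)).symm.toLinearMap ∘ₗ S.m 0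

theorem d_apply (S : AInfModule k A K) (x : K) (a : Fin 0 → A) : S.d x = S.m 0 x a :=
  congrArg (S.m 0 x) (Subsingleton.elim _ _)

/-- The cocycles of degree `p`. -/
def cocycles (S : AInfModule k A K) (p : ℤ) : Submodule k K := S.deg p ⊓ LinearMap.ker S.d

/-- The coboundaries of degree `p`. -/
def coboundaries (S : AInfModule k A K) (p : ℤ) : Submodule k K := (S.deg (p - 1)).map S.d

/-- The cohomology `H^p` of the complex `(K, m₁)`. -/
abbrev Cohomology (S : AInfModule k A K) (p : ℤ) : Type _ :=
  S.cocycles p ⧸ (S.coboundaries p).submoduleOf (S.cocycles p)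

end AInfModule

namespace AInfHom

/-- The first component `f₁ : K → L`. -/
def first {S : AInfModule k A K} {T : AInfModule k A L} (f : AInfHom S T) : K →ₗ[k] L :=
  (MultilinearMap.constLinearEquivOfIsEmpty (R := k) (S := k)
    (M₁ := fun _ : Fin 0 => A) (M₂ := L)).symm.toLinearMap ∘ₗ f.f 0

theorem first_apply {S : AInfModule k A K} {T : AInfModule k A L} (f : AInfHom S T) (x : K)
    (a : Fin 0 → A) : f.first x = f.f 0 x a :=
  congrArg (f.f 0 x) (Subsingleton.elim _ _)

theorem first_mem {S : AInfModule k A K} {T : AInfModule k A L} (f : AInfHom S T) {p : ℤ} {x : K}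
    (hx : x ∈ S.deg p) : f.first x ∈ T.deg p := by
  simpa [f.first_apply x Fin.elim0] using f.f_mem 0 p x hx Fin.elim0

/-- `f₁` is a morphism of complexes. -/
theorem first_d {S : AInfModule k A K} {T : AInfModule k A L} (f : AInfHom S T) (x : K) :
    f.first (S.d x) = T.d (f.first x) := by
  have h := f.rel 0 x (fun _ => 0)
  simp only [Nat.zero_sub, Finset.range_zero, Finset.sum_empty, zero_add,
    Finset.Nat.antidiagonal_zero, Finset.sum_singleton, pow_zero, one_smul, AInf.ev] at h
  rwa [← f.first_apply, ← S.d_apply, ← T.d_apply, ← f.first_apply] at h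

theorem first_mem_cocycles {S : AInfModule k A K} {T : AInfModule k A L} (f : AInfHom S T) (p : ℤ)
    (x : K) (hx : x ∈ S.cocycles p) : f.first x ∈ T.cocycles p := by
  refine ⟨f.first_mem hx.1, LinearMap.mem_ker.2 ?_⟩
  rw [← f.first_d, LinearMap.mem_ker.1 hx.2, map_zero]

/-- The map `H^p(f) : H^p(K) → H^p(L)` induced by `f₁`. -/
def cohomologyMap {S : AInfModule k A K} {T : AInfModule k A L} (f : AInfHom S T) (p : ℤ) :
    S.Cohomology p →ₗ[k] T.Cohomology p :=
  Submodule.mapQ _ _ (f.first.restrict (f.first_mem_cocycles p)) (by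
    rintro ⟨x, hx⟩ hxB
    obtain ⟨z, hz, rfl⟩ := hxB
    exact ⟨f.first z, f.first_mem hz, (f.first_d z).symm⟩)

/-- An A∞-quasi-isomorphism: `H^p(f)` is an isomorphism for all `p`. (`H^p(f)` is `A`-linear for
every morphism `f`, so that it is an isomorphism of `A`-modules if and only if it is bijective.) -/
def IsQuasiIso {S : AInfModule k A K} {T : AInfModule k A L} (f : AInfHom S T) : Prop :=
  ∀ p : ℤ, Function.Bijective (f.cohomologyMap p)

end AInfHom

end Cohomology

/-! ## Modules as A∞-modules -/

section OfModule

open AInf Finset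

variable (k : Type u) (A : Type v) (M : Type w) [Field k] [Ring A] [Algebra k A]
  [AddCommGroup M] [Module k M] [Module Aᵐᵒᵖ M] [IsScalarTower k Aᵐᵒᵖ M]

/-- The structure maps of a right `A`-module `M`: `m₂(x, a) = x a`, and all others vanish. -/
def ofModuleOp : (n : ℕ) → M →ₗ[k] MultilinearMap k (fun _ : Fin n => A) M
  | 1 =>
    { toFun := fun x =>
        { toFun := fun a => MulOpposite.op (a 0) • x
          map_update_add' := fun a i b c => by
            obtain rfl : i = 0 := Subsingleton.elim _ _
            simp [add_smul]
          map_update_smul' := fun a i c b => by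
            obtain rfl : i = 0 := Subsingleton.elim _ _
            simp [smul_assoc] }
      map_add' := fun x y => by ext a; simp
      map_smul' := fun c x => by
        ext a
        simp only [MultilinearMap.coe_mk, _root_.smul_apply, RingHom.id_apply]
        rw [← algebraMap_smul Aᵐᵒᵖ c x, ← algebraMap_smul Aᵐᵒᵖ c (_ • x), smul_smul, smul_smul,
          Algebra.commutes] }
  | _ => 0

theorem ev_ofModuleOp (n : ℕ) (x : M) (a : ℕ → A) :
    ev (ofModuleOp k A M n) x a = if n = 1 then MulOpposite.op (a 0) • x else 0 := by
  match n with
  | 0 => simp [ev, ofModuleOp]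
  | 1 => simp [ev, ofModuleOp]
  | n + 2 => simp [ev, ofModuleOp]

/-- A right `A`-module `M`, regarded as an A∞-module that is concentrated in degree `0`. -/
def AInfModule.ofModule : AInfModule k A M where
  deg p := if p = 0 then ⊤ else ⊥
  isInternal := by
    rw [DirectSum.isInternal_submodule_iff_iSupIndep_and_iSup_eq_top]
    refine ⟨fun p => ?_, ?_⟩
    · by_cases hp : p = 0
      · have : ⨆ j, ⨆ (_ : j ≠ p), (if j = 0 then (⊤ : Submodule k M) else ⊥) = ⊥ := by
          subst hp
          simp only [iSup_eq_bot]
          exact fun j hj => if_neg hj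
        rw [this]
        exact disjoint_bot_right
      · simp only [if_neg hp]
        exact disjoint_bot_left
    · exact eq_top_iff.2 (le_iSup_of_le 0 (by simp))
  m := ofModuleOp k A M
  m_mem n p x hx a := by
    match n with
    | 0 => simp [ofModuleOp]
    | 1 =>
      by_cases hp : p = 0
      · simp [hp]
      · simp only [hp, if_false, Submodule.mem_bot] at hx
        simp [hx]
    | n + 2 => simp [ofModuleOp]
  rel N x a := by
    by_cases hN : N = 2
    · subst hN
      simp [ev_ofModuleOp, Finset.Nat.antidiagonal_succ, shift, contract, smul_smul]
    · rw [sum_eq_zero, sum_eq_zero, add_zero]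
      · rintro ⟨p, q⟩ h
        rw [HasAntidiagonal.mem_antidiagonal] at h
        simp only [ev_ofModuleOp] at h ⊢
        split_ifs <;> first | omega | simp
      · intro i _
        rw [ev_ofModuleOp, if_neg (by omega), smul_zero]
  m_one x := by simp [ofModuleOp]
  m_unit n hn x a i hi := by
    match n with
    | 0 => omega
    | 1 => omega
    | n + 2 => simp [ofModuleOp]

end OfModule

/-! ## A∞-envelopes -/

/-- A finitely generated torsion-free right module of rank `1` over `A`. -/
structure IsRankOneTorsionFree (A : Type v) (M : Type w) [Ring A] [AddCommGroup M]
    [Module Aᵐᵒᵖ M] : Prop where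
  finite : Module.Finite Aᵐᵒᵖ M
  torsionFree : ∀ (a : A) (x : M), MulOpposite.op a • x = 0 → a = 0 ∨ x = 0
  /-- The largest number of linearly independent elements is `1`. -/
  rank : Module.rank Aᵐᵒᵖ M = 1

open WeylAlgebra in
/-- The morphism `r : M → K` of A∞-modules over the Weyl algebra is an A∞-envelope of the right
module `M`. -/
structure IsEnvelope {k : Type u} {M : Type w} {K : Type w'} [Field k]
    [AddCommGroup M] [Module k M] [Module (WeylAlgebra k)ᵐᵒᵖ M]
    [IsScalarTower k (WeylAlgebra k)ᵐᵒᵖ M] [AddCommGroup K] [Module k K]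
    {S : AInfModule k (WeylAlgebra k) K}
    (r : AInfHom (AInfModule.ofModule k (WeylAlgebra k) M) S) : Prop where
  quasiIso : r.IsQuasiIso
  /-- `K = K⁰ ⊕ K¹`. -/
  two_term : ∀ p : ℤ, p ≠ 0 → p ≠ 1 → S.deg p = ⊥
  /-- Finiteness. -/
  finite : FiniteDimensional k (S.deg 1)
  /-- Existence of a regular cyclic vector, and weak associativity. -/
  exists_cyclic : ∃ i ∈ S.deg 0,
    Set.BijOn (fun a : WeylAlgebra k => S.m 1 i ![a]) Set.univ (S.deg 0) ∧
    (∀ v ∈ S.deg 1, ∀ a : WeylAlgebra k, S.m 2 v ![x k, a] = 0) ∧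
    (∀ v ∈ S.deg 1, ∀ a : WeylAlgebra k, S.m 2 v ![a, y k] = 0) ∧
    (∀ v ∈ S.deg 1, S.m 2 v ![y k, x k] ∈ Submodule.span k {i})

/-! Let ξ and η be the operations of `x` and `y` on K⁰. The vanishing of m₃(v, x, a) and m₃(v, a, y)
makes the vectors ηᵇξᵃi, which are the images of xᵃyᵇ, a basis of K⁰. The condition on m₃(v, y, x)
says that ηξ - ξη = 1 - l(·)i for a functional l. Since M has cohomology in degree 0 only, r
identifies M with the kernel of d : K⁰ → K¹ and d is onto. So M has finite codimension in K⁰, and l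
vanishes on M. The main point (`CyclicPair.IsLattice.exists_equiv`) is that M with its two operators
determines K⁰ =: E up to isomorphism.

In the basis, ξ is multiplication by x up to terms of lower degree in y, so p(ξ) is injective for p
≠ 0. By finite codimension there is a monic p such that M contains p(ξ)E, and also p(ξ')E' for a
second envelope. Let h and h' in M correspond to p(ξ)i and p(ξ')i'. Comparison of top coefficients
in y under both embeddings gives h = c h' with a nonzero scalar c (`exists_smul`). By symmetry the
elements given by q(η)i and q(η')i' agree up to a scalar c'.

To prove c = c' and to compare l with l', map E to L[y], where L contains k[x] and the series in
x⁻¹, so that ξ becomes x - ε∂/∂y and η becomes multiplication by y plus the correction ∑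
l(ξⁿu)x⁻ⁿ⁻¹. The correction vanishes on M, so the two realizations of M are proportional
(`realization_eq`). At the element q(η)i this yields c = c' and then, inductively, the equality of
all moments l(ξⁿηʲi) (`moments_eq`). Hence c times the map ηᵇξᵃi ↦ η'ᵇξ'ᵃi' respects both operators
and is the identity on M.

Finally K¹ = K⁰/M, and the relations express all operations on K¹ through those on K⁰, so the
isomorphism extends. It is unique because M contains p(ξ)K⁰ and p(ξ') is injective. -/

open Polynomial

/-! ## Operators that are triangular for the degree -/

section Triangular

variable {k : Type*} [Field k] {S : Type*} [CommRing S] [Algebra k S]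
  {E : Type*} [AddCommGroup E] [Module k E]

/-- In the coordinates `ρ` the operator `T` is multiplication by the scalar `s`, up to terms of
lower degree. -/
def IsTriangular (ρ : E →ₗ[k] S[X]) (s : S) (T : Module.End k E) : Prop :=
  ∀ n u, (ρ u).natDegree ≤ n →
    (ρ (T u)).natDegree ≤ n ∧ (ρ (T u)).coeff n = s * (ρ u).coeff n

theorem IsTriangular.aeval {ρ : E →ₗ[k] S[X]} {s : S} {T : Module.End k E}
    (h : IsTriangular ρ s T) (p : k[X]) :
    IsTriangular ρ (Polynomial.aeval s p) (Polynomial.aeval T p) := by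
  induction p using Polynomial.induction_on with
  | C c =>
    intro n u hu
    rw [aeval_C, aeval_C, Module.algebraMap_end_apply, map_smul]
    exact ⟨(natDegree_smul_le _ _).trans hu, by rw [coeff_smul, Algebra.smul_def]⟩
  | add p q hp hq =>
    intro n u hu
    obtain ⟨h1, h2⟩ := hp n u hu
    obtain ⟨h3, h4⟩ := hq n u hu
    simp only [map_add, LinearMap.add_apply, coeff_add, h2, h4, add_mul, and_true]
    exact natDegree_add_le_of_degree_le h1 h3
  | monomial m c hp =>
    intro n u hu
    obtain ⟨h1, h2⟩ := hp n u hu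
    obtain ⟨h3, h4⟩ := h n _ h1
    have e : (Polynomial.aeval T) (C c * X ^ (m + 1)) = T * (Polynomial.aeval T) (C c * X ^ m) := by
      rw [show C c * X ^ (m + 1) = X * (C c * X ^ m) by ring, map_mul, aeval_X]
    rw [e, Module.End.mul_apply]
    refine ⟨h3, ?_⟩
    rw [h4, h2, pow_succ]
    simp only [map_mul, map_pow, aeval_X, aeval_C]
    ring

/-- The leading coefficient of a nonzero vector is multiplied by `s`, so it cannot disappear. -/
theorem IsTriangular.eq_zero [IsDomain S] {ρ : E →ₗ[k] S[X]} (hρ : Function.Injective ρ) {s : S}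
    (hs : s ≠ 0) {T : Module.End k E} (h : IsTriangular ρ s T) {u : E} (hu : T u = 0) : u = 0 := by
  have := (h _ u le_rfl).2
  rw [hu, map_zero, coeff_zero, eq_comm, mul_eq_zero, or_iff_right hs] at this
  exact hρ (by rw [map_zero]; exact leadingCoeff_eq_zero.1 this)

theorem IsTriangular.natDegree_eq [IsDomain S] {ρ : E →ₗ[k] S[X]} {s : S}
    (hs : s ≠ 0) {T : Module.End k E} (h : IsTriangular ρ s T) (u : E) :
    (ρ (T u)).natDegree = (ρ u).natDegree := by
  refine le_antisymm (h _ u le_rfl).1 ?_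
  by_cases hu : ρ u = 0
  · simp [hu]
  · refine le_natDegree_of_ne_zero ?_
    rw [(h _ u le_rfl).2]
    exact mul_ne_zero hs (leadingCoeff_ne_zero.2 hu)

end Triangular

/-! ## Pairs of operators with a cyclic vector -/

section NormalForm

variable {k : Type*} [Field k] {E : Type*} [AddCommGroup E] [Module k E]

/-- The map `∑ p_b(x) y^b ↦ ∑ η^b p_b(ξ) i`. -/
noncomputable def normalForm (ξ η : Module.End k E) (i : E) : k[X][X] →ₗ[k] E :=
  lsum fun b => (η ^ b) ∘ₗ (LinearMap.applyₗ i) ∘ₗ (aeval ξ).toLinearMap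

theorem normalForm_apply (ξ η : Module.End k E) (i : E) (f : k[X][X]) :
    normalForm ξ η i f = f.sum fun b p => (η ^ b) (aeval ξ p i) := by
  simp [normalForm, lsum_apply]

theorem normalForm_monomial (ξ η : Module.End k E) (i : E) (b : ℕ) (p : k[X]) :
    normalForm ξ η i (monomial b p) = (η ^ b) (aeval ξ p i) := by
  rw [normalForm_apply, sum_monomial_index]
  simp

theorem normalForm_C (ξ η : Module.End k E) (i : E) (p : k[X]) :
    normalForm ξ η i (C p) = aeval ξ p i := by
  rw [← monomial_zero_left, normalForm_monomial, pow_zero, Module.End.one_apply]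

theorem normalForm_X_mul (ξ η : Module.End k E) (i : E) (f : k[X][X]) :
    normalForm ξ η i (X * f) = η (normalForm ξ η i f) := by
  induction f using Polynomial.induction_on' with
  | add p q hp hq => rw [mul_add, map_add, map_add, map_add, hp, hq]
  | monomial n p =>
    rw [X_mul_monomial, normalForm_monomial, normalForm_monomial, pow_succ', Module.End.mul_apply]

end NormalForm

/-- Two operators `ξ` and `η` whose commutator is a scalar up to an operator of rank one, and a
vector `i` such that the vectors `η^b ξ^a i` form a basis. -/
structure CyclicPair (k : Type*) (E : Type*) [Field k] [AddCommGroup E] [Module k E] where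
  /-- The first operator. -/
  ξ : Module.End k E
  /-- The second operator. -/
  η : Module.End k E
  /-- The cyclic vector. -/
  i : E
  /-- The scalar part of the commutator. -/
  ε : k
  /-- The functional that defines the part of rank one of the commutator. -/
  l : E →ₗ[k] k
  comm : ∀ w, η (ξ w) - ξ (η w) = ε • w - l w • i
  bij : Function.Bijective (normalForm ξ η i)

/-! ### Coordinates, triangularity of ξ, and the exchange of the two operators -/

namespace CyclicPair

variable {k : Type*} [Field k] {E : Type*} [AddCommGroup E] [Module k E] (D : CyclicPair k E)

/-- The coordinates with respect to the basis `η^b ξ^a i`. -/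
noncomputable def coord : E ≃ₗ[k] k[X][X] :=
  (LinearEquiv.ofBijective (normalForm D.ξ D.η D.i) D.bij).symm

theorem coord_normalForm (f : k[X][X]) : D.coord (normalForm D.ξ D.η D.i f) = f :=
  (LinearEquiv.ofBijective (normalForm D.ξ D.η D.i) D.bij).symm_apply_apply f

theorem normalForm_coord (u : E) : normalForm D.ξ D.η D.i (D.coord u) = u :=
  (LinearEquiv.ofBijective (normalForm D.ξ D.η D.i) D.bij).apply_symm_apply u

theorem coord_η (u : E) : D.coord (D.η u) = X * D.coord u := by
  rw [← D.coord_normalForm (X * D.coord u), normalForm_X_mul, normalForm_coord]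

theorem coord_η_pow (b : ℕ) (u : E) : D.coord ((D.η ^ b) u) = X ^ b * D.coord u := by
  induction b with
  | zero => simp
  | succ b ih => rw [pow_succ', Module.End.mul_apply, coord_η, ih, pow_succ', mul_assoc]

theorem coord_aeval (p : k[X]) : D.coord (aeval D.ξ p D.i) = C p := by
  rw [← D.coord_normalForm (C p), normalForm_C]

theorem coord_i : D.coord D.i = 1 := by
  simpa using D.coord_aeval 1

theorem ξ_η (w : E) : D.ξ (D.η w) = D.η (D.ξ w) - D.ε • w + D.l w • D.i := by
  have := D.comm w
  rw [sub_eq_iff_eq_add] at this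
  rw [this]; abel

theorem coord_aeval_η (q : k[X]) : D.coord (aeval D.η q D.i) = q.map C := by
  induction q using Polynomial.induction_on' with
  | add p q hp hq => rw [map_add, LinearMap.add_apply, map_add, hp, hq, Polynomial.map_add]
  | monomial n c =>
    rw [aeval_monomial, Module.End.mul_apply, Module.algebraMap_end_apply, map_smul, coord_η_pow,
      coord_i, map_monomial, mul_one, ← C_mul_X_pow_eq_monomial, ← algebraMap_smul k[X] c,
      smul_eq_C_mul]
    rfl

theorem ξ_aeval (p : k[X]) (w : E) : D.ξ (aeval D.ξ p w) = aeval D.ξ (X * p) w := by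
  rw [map_mul, aeval_X, Module.End.mul_apply]

theorem η_aeval (p : k[X]) (w : E) : D.η (aeval D.η p w) = aeval D.η (X * p) w := by
  rw [map_mul, aeval_X, Module.End.mul_apply]

/-- Induction along the basis `η^b ξ^a i`. -/
theorem induction {P : E → Prop} (add : ∀ u v, P u → P v → P (u + v))
    (base : ∀ p : k[X], P (aeval D.ξ p D.i)) (step : ∀ u, P u → P (D.η u)) (u : E) : P u := by
  rw [← D.normalForm_coord u]
  generalize D.coord u = f
  induction f using Polynomial.induction_on' with
  | add p q hp hq => rw [map_add]; exact add _ _ hp hq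
  | monomial n p =>
    rw [normalForm_monomial]
    induction n with
    | zero => exact base p
    | succ n ih => rw [pow_succ', Module.End.mul_apply]; exact step _ ih

/-- Induction on the degree in y: ξη = ηξ - ε + l(·)i, and applied to a vector of degree n the two
correction terms have degree at most n, hence do not reach the coefficient n + 1. -/
theorem isTriangular_ξ : IsTriangular D.coord.toLinearMap X D.ξ := by
  intro n
  induction n with
  | zero =>
    intro u hu
    obtain ⟨p, hp⟩ := natDegree_eq_zero.1 (Nat.le_zero.1 hu)
    obtain rfl : aeval D.ξ p D.i = u := by
      apply D.coord.injective
      rw [coord_aeval]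
      exact hp
    rw [ξ_aeval]
    simp only [LinearEquiv.coe_coe, coord_aeval, natDegree_C, le_refl, coeff_C_zero, and_self]
  | succ n ih =>
    intro u hu
    simp only [LinearEquiv.coe_coe] at hu ih ⊢
    obtain ⟨v, hv⟩ := D.coord.surjective (D.coord u).divX
    have hvn : (D.coord v).natDegree ≤ n := by
      rw [hv, natDegree_divX_eq_natDegree_tsub_one]; omega
    obtain ⟨h1, h2⟩ := ih v hvn
    obtain ⟨p, rfl⟩ : ∃ p : k[X], u = D.η v + aeval D.ξ p D.i := by
      refine ⟨(D.coord u).coeff 0, D.coord.injective ?_⟩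
      rw [map_add, coord_η, coord_aeval, hv, X_mul_divX_add]
    rw [map_add, ξ_η, ξ_aeval]
    have e : D.coord (D.η (D.ξ v) - D.ε • v + D.l v • D.i + aeval D.ξ (X * p) D.i) =
        X * D.coord (D.ξ v) - D.ε • D.coord v + D.l v • 1 + C (X * p) := by
      rw [map_add, map_add, map_sub, coord_η, map_smul, map_smul, coord_i, coord_aeval]
    have h3 : (D.coord v).coeff (n + 1) = 0 := coeff_eq_zero_of_natDegree_lt (by omega)
    rw [e]
    constructor
    · refine natDegree_add_le_of_degree_le (natDegree_add_le_of_degree_le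
        ((natDegree_sub_le_of_le ?_ ?_).trans (max_self _).le) ?_) ?_
      · exact (natDegree_mul_le_of_le natDegree_X_le h1).trans (by omega)
      · exact (natDegree_smul_le _ _).trans (by omega)
      · exact (natDegree_smul_le _ _).trans (by simp)
      · rw [natDegree_C]; omega
    · simp [coord_η, coord_aeval, coeff_X_mul, h2, h3, coeff_one]

theorem isTriangular_aeval (p : k[X]) : IsTriangular D.coord.toLinearMap p (aeval D.ξ p) := by
  simpa using D.isTriangular_ξ.aeval p

theorem eq_zero_of_aeval {p : k[X]} (hp : p ≠ 0) {u : E} (hu : aeval D.ξ p u = 0) : u = 0 :=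
  (D.isTriangular_aeval p).eq_zero D.coord.injective hp hu

/-- The range contains i and is stable under ξ, and by the commutation relation also under η, so it
contains every ηᵇξᵃi. -/
theorem normalForm_swap_surjective : Function.Surjective (normalForm D.η D.ξ D.i) := by
  set W := LinearMap.range (normalForm D.η D.ξ D.i)
  have hi : D.i ∈ W := ⟨C 1, by rw [normalForm_C, map_one, Module.End.one_apply]⟩
  have hξ : ∀ w ∈ W, D.ξ w ∈ W := by
    rintro _ ⟨f, rfl⟩
    exact ⟨X * f, normalForm_X_mul _ _ _ f⟩
  have hη : ∀ w ∈ W, D.η w ∈ W := by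
    rintro _ ⟨f, rfl⟩
    induction f using Polynomial.induction_on' with
    | add p q hp hq => rw [map_add, map_add]; exact W.add_mem hp hq
    | monomial n p =>
      induction n with
      | zero =>
        rw [monomial_zero_left, normalForm_C, η_aeval, ← normalForm_C D.η D.ξ]
        exact ⟨_, rfl⟩
      | succ n ih =>
        rw [← X_mul_monomial, normalForm_X_mul]
        set v := normalForm D.η D.ξ D.i (monomial n p)
        rw [sub_eq_iff_eq_add.1 (D.comm v)]
        exact W.add_mem (W.sub_mem (W.smul_mem _ ⟨_, rfl⟩) (W.smul_mem _ hi)) (hξ _ ih)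
  have hp : ∀ p : k[X], aeval D.ξ p D.i ∈ W := fun p => by
    induction p using Polynomial.induction_on' with
    | add p q hp hq => rw [map_add, LinearMap.add_apply]; exact W.add_mem hp hq
    | monomial n c =>
      rw [aeval_monomial, Module.End.mul_apply, Module.algebraMap_end_apply]
      refine W.smul_mem _ ?_
      induction n with
      | zero => simpa using hi
      | succ n ih => rw [pow_succ', Module.End.mul_apply]; exact hξ _ ih
  exact fun u => D.induction (P := fun u => u ∈ W) (fun _ _ => W.add_mem) hp hη u

theorem normalForm_swap_injective : Function.Injective (normalForm D.η D.ξ D.i) := by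
  rw [injective_iff_map_eq_zero]
  intro f hf
  by_contra hne
  -- Here f stands for ∑ ξᵃ fₐ(η) i. With B the largest degree of the fₐ, triangularity shows that
  -- the coefficient of yᴮ is ∑ xᵃ (fₐ)_B, in which the term a = m is nonzero.
  obtain ⟨m, hm, hmax⟩ := f.support.exists_max_image (fun a => (f.coeff a).natDegree)
    (support_nonempty.2 hne)
  set B := (f.coeff m).natDegree
  have key : ∀ a ∈ f.support, (D.coord ((D.ξ ^ a) (aeval D.η (f.coeff a) D.i))).coeff B =
      X ^ a * C ((f.coeff a).coeff B) := fun a ha => by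
    have h := (D.isTriangular_aeval (X ^ a) B (aeval D.η (f.coeff a) D.i) (by
      rw [LinearEquiv.coe_coe, coord_aeval_η]
      exact natDegree_map_le.trans (hmax a ha))).2
    rw [map_pow, aeval_X, LinearEquiv.coe_coe, coord_aeval_η, coeff_map] at h
    exact h
  have h0 : (D.coord (normalForm D.η D.ξ D.i f)).coeff B = 0 := by rw [hf, map_zero, coeff_zero]
  rw [normalForm_apply, Polynomial.sum, map_sum, finsetSum_coeff, Finset.sum_congr rfl key] at h0
  have h1 := congrArg (fun p => coeff p m) h0
  simp only [finsetSum_coeff, coeff_X_pow_mul', coeff_C, coeff_zero] at h1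
  rw [Finset.sum_eq_single m] at h1
  · simp only [le_refl, Nat.sub_self, if_true] at h1
    exact mem_support_iff.1 hm (leadingCoeff_eq_zero.1 h1)
  · intro a _ ha
    split_ifs <;> first | omega | rfl
  · exact fun h => absurd hm h

/-- The roles of the two operators are symmetric. -/
@[simps]
noncomputable def swap : CyclicPair k E where
  ξ := D.η
  η := D.ξ
  i := D.i
  ε := -D.ε
  l := -D.l
  comm w := by rw [← neg_sub, D.comm, LinearMap.neg_apply, neg_smul, neg_smul]; abel
  bij := ⟨D.normalForm_swap_injective, D.normalForm_swap_surjective⟩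

end CyclicPair

/-! ### Intertwined operators and invariant subspaces of finite codimension -/

section Intertwining

variable {k : Type*} [Field k] {M E : Type*} [AddCommGroup M] [Module k M]
  [AddCommGroup E] [Module k E]

theorem map_aeval_of_intertwining {a : Module.End k M} {T : Module.End k E} {r : M →ₗ[k] E}
    (h : ∀ m, r (a m) = T (r m)) (p : k[X]) (m : M) : r (aeval a p m) = aeval T p (r m) := by
  induction p using Polynomial.induction_on' with
  | add p q hp hq => simp only [map_add, LinearMap.add_apply, hp, hq]
  | monomial n c =>
    simp only [aeval_monomial, Module.End.mul_apply, Module.algebraMap_end_apply, map_smul]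
    congr 1
    induction n with
    | zero => rfl
    | succ n ih => rw [pow_succ', pow_succ', Module.End.mul_apply, Module.End.mul_apply, h, ih]

theorem map_pow_of_intertwining {a : Module.End k M} {T : Module.End k E} {r : M →ₗ[k] E}
    (h : ∀ m, r (a m) = T (r m)) (n : ℕ) (m : M) : r ((a ^ n) m) = (T ^ n) (r m) := by
  simpa using map_aeval_of_intertwining h (X ^ n) m

/-- An invariant subspace of finite codimension contains the image of a polynomial in the
operator. -/
theorem exists_monic_aeval_mem_range {a : Module.End k M} {T : Module.End k E} {r : M →ₗ[k] E}
    (h : ∀ m, r (a m) = T (r m)) (hfin : Module.Finite k (E ⧸ LinearMap.range r)) :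
    ∃ p : k[X], p.Monic ∧ ∀ u, ∃ m, r m = aeval T p u := by
  have hle : LinearMap.range r ≤ (LinearMap.range r).comap T := by
    rintro _ ⟨m, rfl⟩
    exact ⟨a m, h m⟩
  set T' : Module.End k (E ⧸ LinearMap.range r) := (LinearMap.range r).mapQ _ T hle
  -- The minimal polynomial of the operator induced on the finite-dimensional quotient annihilates
  -- that quotient.
  refine ⟨minpoly k T', minpoly.monic (Algebra.IsIntegral.isIntegral T'), fun u => ?_⟩
  have h1 := map_aeval_of_intertwining (a := T) (T := T') (r := (LinearMap.range r).mkQ)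
    (fun _ => rfl) (minpoly k T') u
  rw [minpoly.aeval, LinearMap.zero_apply, Submodule.mkQ_apply, Submodule.Quotient.mk_eq_zero] at h1
  exact h1

end Intertwining

/-! ### Lattices: two embeddings of the same module compared by leading coefficients -/

namespace CyclicPair

variable {k : Type*} [Field k] {M E E' : Type*} [AddCommGroup M] [Module k M]
  [AddCommGroup E] [Module k E] [AddCommGroup E'] [Module k E']

/-- `M` embeds as an invariant subspace of finite codimension on which the part of rank one of the
commutator vanishes. -/
structure IsLattice (D : CyclicPair k E) (a b : Module.End k M) (r : M →ₗ[k] E) : Prop where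
  inj : Function.Injective r
  map_ξ : ∀ m, r (a m) = D.ξ (r m)
  map_η : ∀ m, r (b m) = D.η (r m)
  l_eq_zero : ∀ m, D.l (r m) = 0
  finite : Module.Finite k (E ⧸ LinearMap.range r)

namespace IsLattice

variable {D : CyclicPair k E} {D' : CyclicPair k E'} {a b : Module.End k M} {r : M →ₗ[k] E}
  {r' : M →ₗ[k] E'}

theorem swap (h : D.IsLattice a b r) : D.swap.IsLattice b a r :=
  ⟨h.inj, h.map_η, h.map_ξ, fun m => by simp [h.l_eq_zero m], h.finite⟩

theorem map_aeval (h : D.IsLattice a b r) (p : k[X]) (m : M) :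
    r (aeval a p m) = aeval D.ξ p (r m) :=
  map_aeval_of_intertwining h.map_ξ p m

/-- The product of the two annihilating polynomials serves both embeddings, and a common p is what
allows the vectors p(ξ)i and p(ξ')i' to be compared inside M. -/
theorem exists_monic (h : D.IsLattice a b r) (h' : D'.IsLattice a b r') :
    ∃ p : k[X], p.Monic ∧ (∀ u, ∃ m, r m = aeval D.ξ p u) ∧ ∀ u, ∃ m, r' m = aeval D'.ξ p u := by
  obtain ⟨p, hp, H⟩ := exists_monic_aeval_mem_range h.map_ξ h.finite
  obtain ⟨p', hp', H'⟩ := exists_monic_aeval_mem_range h'.map_ξ h'.finite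
  refine ⟨p * p', hp.mul hp', fun u => ?_, fun u => ?_⟩
  · rw [map_mul, Module.End.mul_apply]; exact H _
  · rw [mul_comm, map_mul, Module.End.mul_apply]; exact H' _

/-- Up to a polynomial in the first operator, every element of `M` is a combination of the elements
`b^n h`, where `h` corresponds to `p(ξ) i`. -/
theorem reduction (hr : D.IsLattice a b r) {p : k[X]} {h : M} (hh : r h = aeval D.ξ p D.i)
    (n : ℕ) (m : M) (hm : (D.coord (r m)).degree < (n + 1 : ℕ)) :
    ∃ m₁, (D.coord (r m₁)).degree < n ∧
      aeval a p m = aeval a ((D.coord (r m)).coeff n) ((b ^ n) h) + m₁ := by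
  set q := (D.coord (r m)).coeff n
  refine ⟨aeval a p m - aeval a q ((b ^ n) h), ?_, by abel⟩
  have hd : (D.coord (r m)).natDegree ≤ n :=
    natDegree_le_iff_degree_le.2 (Order.lt_succ_iff.1 (by exact_mod_cast hm))
  rw [map_sub, hr.map_aeval, hr.map_aeval, map_pow_of_intertwining hr.map_η, hh, map_sub,
    degree_lt_iff_coeff_zero]
  obtain ⟨h1, h2⟩ := D.isTriangular_aeval p n (r m) hd
  have h3 : D.coord ((D.η ^ n) (aeval D.ξ p D.i)) = X ^ n * C p := by
    rw [coord_η_pow, coord_aeval]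
  obtain ⟨h4, h5⟩ := D.isTriangular_aeval q n ((D.η ^ n) (aeval D.ξ p D.i)) (by
    rw [LinearEquiv.coe_coe, h3, mul_comm]; exact natDegree_C_mul_X_pow_le _ _)
  rw [LinearEquiv.coe_coe] at h1 h2 h4 h5
  intro j hj
  rw [coeff_sub]
  rcases hj.eq_or_lt with rfl | hj
  -- Both terms have n-th coefficient p q, so the difference drops in degree.
  · rw [h2, h5, h3, mul_comm (X ^ _), coeff_C_mul_X_pow,
      if_pos rfl, mul_comm, sub_self]
  · rw [coeff_eq_zero_of_natDegree_lt (h1.trans_lt hj),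
      coeff_eq_zero_of_natDegree_lt (h4.trans_lt hj), sub_self]

/-- A map that intertwines the operators is determined by its value at `p(ξ) i`. -/
theorem eq_zero_of_intertwining (hr : D.IsLattice a b r) {p : k[X]} {h : M}
    (hh : r h = aeval D.ξ p D.i) {W : Type*} [AddCommGroup W] [Module k W]
    {s t : Module.End k W} (hs : ∀ w, aeval s p w = 0 → w = 0) {F : M →ₗ[k] W}
    (hFa : ∀ m, F (a m) = s (F m)) (hFb : ∀ m, F (b m) = t (F m)) (hF : F h = 0) (m : M) :
    F m = 0 := by
  suffices H : ∀ n : ℕ, ∀ m, (D.coord (r m)).degree < n → F m = 0 from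
    H _ m (degree_le_natDegree.trans_lt (by exact_mod_cast Nat.lt_succ_self _))
  intro n
  induction n with
  | zero =>
    intro m hm
    have h0 : r m = 0 := D.coord.injective (by
      rw [map_zero, ← degree_eq_bot]
      simpa using hm)
    rw [hr.inj (h0.trans (map_zero r).symm), map_zero]
  | succ n ih =>
    intro m hm
    obtain ⟨m₁, h1, h2⟩ := hr.reduction hh n m hm
    -- By the reduction, p(s) F(m) = q(s) tⁿ F(h) + F(m₁), where F(h) = 0 and F(m₁) = 0 by induction
    -- on the degree.
    apply hs
    rw [← map_aeval_of_intertwining hFa, h2, map_add, ih m₁ h1, map_aeval_of_intertwining hFa,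
      map_pow_of_intertwining hFb, hF, map_zero, map_zero, add_zero]

/-- By the reduction p(a) m equals q(a) bⁿ h up to lower degree, where q is the n-th coefficient of
m. Reading this identity in the second embedding, where p(a) and q(a) multiply top coefficients by p
and q, bounds the degree of m there and gives its top coefficient up to the factor p. -/
theorem degree_comparison (hr : D.IsLattice a b r) (hr' : D'.IsLattice a b r') {p : k[X]}
    (hp : p ≠ 0) {h : M} (hh : r h = aeval D.ξ p D.i) {e : ℕ}
    (he : (D'.coord (r' h)).natDegree ≤ e) (n : ℕ) (m : M) (hm : (D.coord (r m)).natDegree ≤ n) :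
    (D'.coord (r' m)).natDegree ≤ n + e ∧ p * (D'.coord (r' m)).coeff (n + e) =
      (D.coord (r m)).coeff n * (D'.coord (r' h)).coeff e := by
  induction n generalizing m with
  | zero =>
    obtain ⟨m₁, h1, h2⟩ := hr.reduction hh 0 m
      (degree_le_natDegree.trans_lt (by exact_mod_cast Nat.lt_succ_of_le hm))
    have h0 : r m₁ = 0 := D.coord.injective (by
      rw [map_zero, ← degree_eq_bot]
      simpa using h1)
    rw [hr.inj (h0.trans (map_zero r).symm), add_zero, pow_zero, Module.End.one_apply] at h2
    have h3 := congrArg r' h2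
    rw [hr'.map_aeval, hr'.map_aeval] at h3
    obtain ⟨h4, h5⟩ := D'.isTriangular_aeval ((D.coord (r m)).coeff 0) e (r' h) he
    rw [← h3, LinearEquiv.coe_coe] at h4 h5
    have h6 := (D'.isTriangular_aeval p).natDegree_eq hp (r' m)
    rw [LinearEquiv.coe_coe] at h6
    rw [h6] at h4
    rw [zero_add]
    exact ⟨h4, by rw [← h5]; exact ((D'.isTriangular_aeval p e (r' m) h4).2).symm⟩
  | succ n ih =>
    obtain ⟨m₁, h1, h2⟩ := hr.reduction hh (n + 1) m
      (degree_le_natDegree.trans_lt (by exact_mod_cast Nat.lt_succ_of_le hm))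
    have h3 := congrArg (fun m => D'.coord (r' m)) h2
    simp only [map_add, hr'.map_aeval, map_pow_of_intertwining hr'.map_η] at h3
    have hd : (D'.coord ((D'.η ^ (n + 1)) (r' h))).natDegree ≤ n + 1 + e := by
      rw [coord_η_pow, add_comm]
      exact natDegree_mul_le_of_le (natDegree_X_pow_le _) he |>.trans (by omega)
    obtain ⟨h4, h5⟩ := D'.isTriangular_aeval ((D.coord (r m)).coeff (n + 1)) (n + 1 + e)
      ((D'.η ^ (n + 1)) (r' h)) hd
    have h6 := (ih m₁ (natDegree_le_iff_degree_le.2 (Order.lt_succ_iff.1 (by exact_mod_cast h1)))).1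
    have h7 := (D'.isTriangular_aeval p).natDegree_eq hp (r' m)
    rw [LinearEquiv.coe_coe] at h4 h5 h7
    have h8 : (D'.coord (r' m)).natDegree ≤ n + 1 + e := by
      rw [← h7, h3]
      exact natDegree_add_le_of_degree_le h4 (h6.trans (by omega))
    refine ⟨h8, ?_⟩
    have h9 := (D'.isTriangular_aeval p _ (r' m) h8).2
    rw [LinearEquiv.coe_coe] at h9
    rw [← h9, h3, coeff_add, h5,
      coeff_eq_zero_of_natDegree_lt (p := D'.coord (r' m₁)) (by omega), add_zero, coord_η_pow,
      add_comm (n + 1) e, coeff_X_pow_mul]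

/-- The cyclic vectors agree up to a nonzero scalar and up to torsion. -/
theorem exists_smul (hr : D.IsLattice a b r) (hr' : D'.IsLattice a b r') {p : k[X]}
    (hp : p.Monic) {h h' : M} (hh : r h = aeval D.ξ p D.i) (hh' : r' h' = aeval D'.ξ p D'.i) :
    ∃ c : k, c ≠ 0 ∧ h = c • h' := by
  obtain ⟨q, hq, hqr, hqr'⟩ := hr.swap.exists_monic hr'.swap
  obtain ⟨m, hm⟩ := hqr D.i
  obtain ⟨m', hm'⟩ := hqr' D'.i
  change r m = aeval D.η q D.i at hm
  change r' m' = aeval D'.η q D'.i at hm'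
  have hp0 := hp.ne_zero
  have hlc : ∀ m : M, m ≠ 0 → (D.coord (r m)).leadingCoeff ≠ 0 := fun m hm => by
    rw [leadingCoeff_ne_zero, Ne, LinearEquiv.map_eq_zero_iff, map_eq_zero_iff r hr.inj]
    exact hm
  have hlc' : ∀ m : M, m ≠ 0 → (D'.coord (r' m)).leadingCoeff ≠ 0 := fun m hm => by
    rw [leadingCoeff_ne_zero, Ne, LinearEquiv.map_eq_zero_iff, map_eq_zero_iff r' hr'.inj]
    exact hm
  have hne : h ≠ 0 := by
    rintro rfl
    rw [map_zero] at hh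
    have := D.coord_aeval p
    rw [← hh, map_zero, eq_comm, C_eq_zero] at this
    exact hp0 this
  have hne' : h' ≠ 0 := by
    rintro rfl
    rw [map_zero] at hh'
    have := D'.coord_aeval p
    rw [← hh', map_zero, eq_comm, C_eq_zero] at this
    exact hp0 this
  -- the degrees with respect to the two embeddings agree
  have he : (D'.coord (r' h)).natDegree = 0 := by
    -- For m = h' the coefficient of degree n + e in the second embedding is nonzero, but r' h' has
    -- the constant coordinate p. Hence n + e = 0.
    have h1 := (degree_comparison hr hr' hp0 hh le_rfl _ h' le_rfl).2
    have h2 := mul_ne_zero (hlc _ hne') (hlc' _ hne)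
    rw [leadingCoeff, leadingCoeff, ← h1, hh', coord_aeval] at h2
    have h3 := le_natDegree_of_ne_zero (right_ne_zero_of_mul h2)
    rw [natDegree_C] at h3
    omega
  obtain ⟨ρ, hρ⟩ := natDegree_eq_zero.1 he
  have hρ0 : ρ ≠ 0 := by
    rintro rfl
    have := hlc' _ hne
    rw [← hρ] at this
    simp at this
  have hdeg : ∀ n m, (D.coord (r m)).natDegree ≤ n → (D'.coord (r' m)).natDegree ≤ n ∧
      p * (D'.coord (r' m)).coeff n = (D.coord (r m)).coeff n * ρ := fun n m hm => by
    have := degree_comparison hr hr' hp0 hh he.le n m hm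
    rwa [← hρ, coeff_C_zero] at this
  have hb : (q.map (C : k →+* k[X])).natDegree = q.natDegree := natDegree_map_eq_of_injective
    C_injective q
  have hb1 : (q.map (C : k →+* k[X])).coeff q.natDegree = 1 := by
    rw [coeff_map, hq.coeff_natDegree, map_one]
  have hdvd : p ∣ ρ := by
    -- The vector q(η)i has top coefficient 1 because q is monic, so p times some polynomial is ρ.
    have h1 := (hdeg q.natDegree m (by rw [hm, coord_aeval_η, hb])).2
    rw [hm, coord_aeval_η, hb1, one_mul] at h1
    exact ⟨_, h1.symm⟩
  have hdvd' : ρ ∣ p := by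
    have hm0 : m' ≠ 0 := by
      rintro rfl
      rw [map_zero] at hm'
      rw [← D'.coord_aeval_η, ← hm', map_zero, coeff_zero] at hb1
      exact zero_ne_one hb1
    -- Now the top coefficient is 1 in the second embedding. The product of leading coefficients
    -- being nonzero forces equal degrees in both embeddings, so p is a multiple of ρ.
    have h1 := hdeg _ m' le_rfl
    have h2 := mul_ne_zero (hlc _ hm0) hρ0
    rw [leadingCoeff, ← h1.2] at h2
    rw [hm', coord_aeval_η, hb] at h1
    rw [hm', coord_aeval_η] at h2
    have h3 := le_natDegree_of_ne_zero (right_ne_zero_of_mul h2)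
    rw [hb] at h3
    have h4 : q.natDegree = (D.coord (r m')).natDegree := le_antisymm h1.1 h3
    rw [← h4, hb1, mul_one] at h1
    exact ⟨_, h1.2.trans (mul_comm _ _)⟩
  obtain ⟨u, hu⟩ := associated_of_dvd_dvd hdvd hdvd'
  obtain ⟨c, hc, hcu⟩ := Polynomial.isUnit_iff.1 u.isUnit
  refine ⟨c, hc.ne_zero, hr'.inj (D'.coord.injective ?_)⟩
  rw [map_smul, map_smul, hh', coord_aeval, ← hρ, ← hu, ← hcu, ← algebraMap_smul k[X] c,
    smul_eq_C_mul, ← C_mul, mul_comm]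
  rfl

end IsLattice

end CyclicPair

/-! ## Series in the inverse of the variable -/

/-- A domain that contains the polynomials in `x` and the series `∑ s_n x^{-n-1}`. -/
structure TailRing (k L : Type*) [Field k] [CommRing L] [Algebra k L] where
  /-- The variable. -/
  x : L
  /-- The series `∑ s_n x^{-n-1}`. -/
  tail : (ℕ → k) →ₗ[k] L
  x_mul_tail (s : ℕ → k) : x * tail s = tail (fun n => s (n + 1)) + algebraMap k L (s 0)
  tail_injective : Function.Injective tail
  aeval_ne_zero (p : k[X]) : p ≠ 0 → aeval x p ≠ 0

/-- Laurent series in `z = x⁻¹`. -/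
noncomputable def TailRing.laurent (k : Type*) [Field k] :
    TailRing k (FractionRing (PowerSeries k)) where
  x := (algebraMap (PowerSeries k) _ PowerSeries.X)⁻¹
  tail := LinearMap.mulLeft k (algebraMap (PowerSeries k) _ PowerSeries.X) ∘ₗ
    (IsScalarTower.toAlgHom k (PowerSeries k) (FractionRing (PowerSeries k))).toLinearMap ∘ₗ
    { toFun := PowerSeries.mk
      map_add' := fun s t => by ext; simp
      map_smul' := fun c s => by ext; simp }
  x_mul_tail s := by
    have h : PowerSeries.mk s = PowerSeries.X * PowerSeries.mk (fun n => s (n + 1)) +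
        algebraMap k (PowerSeries k) (s 0) := by
      ext n
      cases n <;> simp [PowerSeries.coeff_succ_X_mul]
    have h0 : algebraMap (PowerSeries k) (FractionRing (PowerSeries k)) PowerSeries.X ≠ 0 := by
      simp [PowerSeries.X_ne_zero]
    simp only [LinearMap.comp_apply, LinearMap.mulLeft_apply, LinearMap.coe_mk, AddHom.coe_mk,
      AlgHom.toLinearMap_apply, IsScalarTower.coe_toAlgHom']
    rw [inv_mul_cancel_left₀ h0, h, map_add, map_mul, ← IsScalarTower.algebraMap_apply]
  tail_injective s t h := by
    have h0 : algebraMap (PowerSeries k) (FractionRing (PowerSeries k)) PowerSeries.X ≠ 0 := by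
      simp [PowerSeries.X_ne_zero]
    have h1 := FaithfulSMul.algebraMap_injective (PowerSeries k) (FractionRing (PowerSeries k))
      (mul_left_cancel₀ h0 h)
    funext n
    simpa using congrArg (PowerSeries.coeff n) h1
  aeval_ne_zero p hp h := by
    have h0 : algebraMap (PowerSeries k) (FractionRing (PowerSeries k)) PowerSeries.X ≠ 0 := by
      simp [PowerSeries.X_ne_zero]
    let _ := invertibleOfNonzero (inv_ne_zero h0)
    -- If p vanishes at z⁻¹, then the reversed polynomial vanishes at z, where it is itself a power
    -- series.
    have h1 := (eval₂_reverse_eq_zero_iff (algebraMap k (FractionRing (PowerSeries k)))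
      (algebraMap (PowerSeries k) (FractionRing (PowerSeries k)) PowerSeries.X)⁻¹ p).2 h
    rw [invOf_eq_inv, inv_inv, ← aeval_def, aeval_algebraMap_apply,
      FaithfulSMul.algebraMap_eq_zero_iff] at h1
    have h2 : ∀ q : k[X], aeval (PowerSeries.X : PowerSeries k) q = (q : PowerSeries k) :=
      fun q => (eval₂_C_X_eq_coe (φ := q) :)
    rw [h2, Polynomial.coe_eq_zero_iff, reverse_eq_zero] at h1
    exact hp h1

section LaurentOp

variable {k L : Type*} [Field k] [CommRing L] [Algebra k L] (𝓛 : TailRing k L)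

/-- The operator `x - ε ∂/∂y`. -/
noncomputable def TailRing.op (ε : k) : Module.End k L[X] :=
  LinearMap.mulLeft k (C 𝓛.x) - ε • ((derivative (R := L)).restrictScalars k)

theorem TailRing.op_apply (ε : k) (f : L[X]) :
    𝓛.op ε f = C (𝓛.x) * f - ε • derivative f := rfl

theorem TailRing.op_X_mul (ε : k) (f : L[X]) :
    𝓛.op ε (X * f) = X * 𝓛.op ε f - ε • f := by
  rw [TailRing.op_apply, TailRing.op_apply, derivative_mul, derivative_X, one_mul, smul_add,
    mul_sub, mul_smul_comm, mul_left_comm]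
  abel

theorem TailRing.isTriangular_op (ε : k) :
    IsTriangular (LinearMap.id : L[X] →ₗ[k] L[X])
      (𝓛.x) (𝓛.op ε) := by
  intro n f hf
  simp only [LinearMap.id_apply] at hf ⊢
  rw [TailRing.op_apply]
  constructor
  · refine (natDegree_sub_le_of_le (natDegree_C_mul_le _ _)
      ((natDegree_smul_le _ _).trans (natDegree_derivative_le f))).trans ?_
    simp only [sup_le_iff]
    omega
  · rw [coeff_sub, coeff_smul, coeff_derivative, coeff_C_mul,
      coeff_eq_zero_of_natDegree_lt (by omega : f.natDegree < n + 1), zero_mul, smul_zero, sub_zero]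

end LaurentOp

/-! ### Realization by x - ε∂/∂y, moments, and reconstruction of the pair from a lattice -/

namespace CyclicPair

variable {k : Type*} [Field k] {M E E' : Type*} [AddCommGroup M] [Module k M]
  [AddCommGroup E] [Module k E] [AddCommGroup E'] [Module k E']
  {L : Type*} [CommRing L] [Algebra k L]

/-- The generating series of the functionals `l ∘ ξ^n`. -/
noncomputable def series (D : CyclicPair k E) (𝓛 : TailRing k L) : E →ₗ[k] L :=
  𝓛.tail ∘ₗ LinearMap.pi fun n => D.l ∘ₗ (D.ξ ^ n)

theorem x_mul_series (D : CyclicPair k E) (𝓛 : TailRing k L) (u : E) :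
    𝓛.x * D.series 𝓛 u = D.series 𝓛 (D.ξ u) + algebraMap k _ (D.l u) :=
  𝓛.x_mul_tail _

theorem series_eq_zero (D : CyclicPair k E) (𝓛 : TailRing k L) {u : E}
    (h : ∀ n, D.l ((D.ξ ^ n) u) = 0) : D.series 𝓛 u = 0 := by
  rw [series, LinearMap.comp_apply, show (LinearMap.pi fun n => D.l ∘ₗ (D.ξ ^ n)) u = 0 from
    funext h, map_zero]

/-- A realization of the space in which the first operator is `x - ε ∂/∂y`, and the second one is
the multiplication by `y` up to a correction of degree zero. -/
noncomputable def realization (D : CyclicPair k E) (𝓛 : TailRing k L) : E →ₗ[k] L[X] :=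
  (lsum fun b => (monomial b).restrictScalars k ∘ₗ (aeval (𝓛.x)).toLinearMap +
    ∑ m ∈ Finset.range b, (monomial (b - 1 - m)).restrictScalars k ∘ₗ D.series 𝓛 ∘ₗ (D.η ^ m) ∘ₗ
      LinearMap.applyₗ D.i ∘ₗ (aeval D.ξ).toLinearMap) ∘ₗ D.coord.toLinearMap

/-- This is the recursion `realization_η` unrolled from p(x): the series that enters at stage m is
afterwards multiplied by y another b - 1 - m times. -/
theorem realization_basis (D : CyclicPair k E) (𝓛 : TailRing k L) (b : ℕ) (p : k[X]) :
    D.realization 𝓛 ((D.η ^ b) (aeval D.ξ p D.i)) = monomial b (aeval (𝓛.x) p) +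
      ∑ m ∈ Finset.range b, monomial (b - 1 - m) (D.series 𝓛 ((D.η ^ m) (aeval D.ξ p D.i))) := by
  rw [realization, LinearMap.comp_apply, LinearEquiv.coe_coe, ← normalForm_monomial,
    coord_normalForm, lsum_apply, sum_monomial_index]
  · simp [LinearMap.sum_apply]
  · simp

theorem realization_aeval (D : CyclicPair k E) (𝓛 : TailRing k L) (p : k[X]) :
    D.realization 𝓛 (aeval D.ξ p D.i) = C (aeval (𝓛.x) p) := by
  simpa using (D.realization_basis 𝓛) 0 p

theorem realization_i (D : CyclicPair k E) (𝓛 : TailRing k L) : D.realization 𝓛 D.i = 1 := by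
  simpa using (D.realization_aeval 𝓛) 1

theorem realization_η (D : CyclicPair k E) (𝓛 : TailRing k L) (u : E) :
    D.realization 𝓛 (D.η u) = X * D.realization 𝓛 u + C (D.series 𝓛 u) := by
  rw [← D.normalForm_coord u]
  generalize D.coord u = f
  induction f using Polynomial.induction_on' with
  | add p q hp hq => simp only [map_add, hp, hq]; ring
  | monomial b p =>
    rw [normalForm_monomial, ← Module.End.mul_apply, ← pow_succ', realization_basis,
      realization_basis, Finset.sum_range_succ, mul_add, X_mul_monomial, Finset.mul_sum]
    simp only [X_mul_monomial, Nat.add_sub_cancel, Nat.sub_self, monomial_zero_left]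
    rw [add_assoc]
    congr 2
    refine Finset.sum_congr rfl fun m hm => ?_
    rw [Finset.mem_range] at hm
    congr 2
    omega

/-- On the vectors p(ξ)i both sides are multiplication by x. In the passage from u to ηu, the rank
one term l(u)i of the commutator is matched by the constant l(u) that splits off when the series of
u is multiplied by x. -/
theorem realization_ξ (D : CyclicPair k E) (𝓛 : TailRing k L) (u : E) :
    D.realization 𝓛 (D.ξ u) = 𝓛.op D.ε (D.realization 𝓛 u) := by
  induction u using D.induction with
  | add u v hu hv => simp only [map_add, hu, hv]
  | base p =>
    rw [ξ_aeval, realization_aeval, realization_aeval, 𝓛.op_apply, derivative_C, smul_zero,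
      sub_zero, map_mul, aeval_X, C_mul]
  | step u hu =>
    rw [ξ_η, map_add, map_sub, realization_η, realization_η, hu, map_add, 𝓛.op_X_mul,
      𝓛.op_apply (f := C _), derivative_C, smul_zero, sub_zero, ← C_mul, x_mul_series,
      map_smul, map_smul, realization_i, C_add,
      show C (algebraMap k (L) (D.l u)) = D.l u • 1 from
        Algebra.algebraMap_eq_smul_one (A := L[X]) (D.l u)]
    abel

theorem realization_pow (D : CyclicPair k E) (𝓛 : TailRing k L) (n : ℕ) :
    (D.realization 𝓛 ((D.η ^ n) D.i)).natDegree ≤ n ∧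
      (D.realization 𝓛 ((D.η ^ n) D.i)).coeff n = 1 := by
  induction n with
  | zero => simp [realization_i]
  | succ n ih =>
    rw [pow_succ', Module.End.mul_apply, realization_η]
    constructor
    · refine natDegree_add_le_of_degree_le
        ((natDegree_mul_le_of_le natDegree_X_le ih.1).trans (by omega)) (by simp)
    · simp [coeff_X_mul, ih.2]

namespace IsLattice

variable {D : CyclicPair k E} {D' : CyclicPair k E'} {a b : Module.End k M} {r : M →ₗ[k] E}
  {r' : M →ₗ[k] E'}

theorem series_eq_zero (𝓛 : TailRing k L) (h : D.IsLattice a b r) (m : M) : D.series 𝓛 (r m) = 0 :=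
  D.series_eq_zero 𝓛 fun n => by rw [← map_pow_of_intertwining h.map_ξ, h.l_eq_zero]

/-- On M the series vanish, so both realizations intertwine a and b with x - ε∂/∂y and
multiplication by y. They are therefore determined by their values at h, which differ by the factor
c. -/
theorem realization_eq [IsDomain L] (𝓛 : TailRing k L) (hr : D.IsLattice a b r)
    (hr' : D'.IsLattice a b r') (hε : D.ε = D'.ε) {p : k[X]} (hp : p ≠ 0) {h : M}
    (hh : r h = aeval D.ξ p D.i) {c : k}
    (hh' : r' h = c • aeval D'.ξ p D'.i) (m : M) :
    D'.realization 𝓛 (r' m) = c • D.realization 𝓛 (r m) := by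
  rw [← sub_eq_zero]
  refine hr.eq_zero_of_intertwining hh (s := 𝓛.op D.ε) (t := LinearMap.mulLeft k X)
    (F := D'.realization 𝓛 ∘ₗ r' - c • (D.realization 𝓛 ∘ₗ r)) (fun w hw => ?_) (fun m => ?_)
    (fun m => ?_) ?_ m
  · exact ((𝓛.isTriangular_op D.ε).aeval p).eq_zero Function.injective_id
      (𝓛.aeval_ne_zero p hp) hw
  · simp [hr.map_ξ, hr'.map_ξ, realization_ξ, hε]
  · simp [hr.map_η, hr'.map_η, realization_η, series_eq_zero 𝓛 hr, series_eq_zero 𝓛 hr', mul_sub]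
  · simp [hh, hh', realization_aeval]

/-- The scalars that relate the cyclic vectors up to torsion for the two operators agree, and so do
the moments of the two pairs. -/
theorem moments_eq [IsDomain L] (𝓛 : TailRing k L) (hr : D.IsLattice a b r)
    (hr' : D'.IsLattice a b r') (hε : D.ε = D'.ε) {p : k[X]} (hp : p ≠ 0) {h : M}
    (hh : r h = aeval D.ξ p D.i) {c : k} (hc : c ≠ 0)
    (hh' : r' h = c • aeval D'.ξ p D'.i) {q : k[X]} (hq : q.Monic) {g : M}
    (hg : r g = aeval D.η q D.i) {c' : k} (hg' : r' g = c' • aeval D'.η q D'.i) :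
    c = c' ∧ ∀ n j, D.l ((D.ξ ^ n) ((D.η ^ j) D.i)) = D'.l ((D'.ξ ^ n) ((D'.η ^ j) D'.i)) := by
  set φ : ℕ → L[X] := fun j => D.realization 𝓛 ((D.η ^ j) D.i) with hφ
  set φ' : ℕ → L[X] := fun j => D'.realization 𝓛 ((D'.η ^ j) D'.i) with hφ'
  have hφs : ∀ j, φ (j + 1) = X * φ j + C (D.series 𝓛 ((D.η ^ j) D.i)) := fun j => by
    simp only [hφ, pow_succ', Module.End.mul_apply, realization_η]
  have hφs' : ∀ j, φ' (j + 1) = X * φ' j + C (D'.series 𝓛 ((D'.η ^ j) D'.i)) := fun j => by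
    simp only [hφ', pow_succ', Module.End.mul_apply, realization_η]
  -- The proportionality of the realizations at bʲ g, expanded in the coefficients of q.
  have hrel : ∀ j, c' • q.sum (fun n d => d • φ' (j + n)) = c • q.sum fun n d => d • φ (j + n) :=
    fun j => by
    have h1 := realization_eq 𝓛 hr hr' hε hp hh hh' ((b ^ j) g)
    rw [map_pow_of_intertwining hr.map_η, map_pow_of_intertwining hr'.map_η, hg, hg', map_smul,
      map_smul, aeval_endomorphism, aeval_endomorphism, Polynomial.sum, Polynomial.sum] at h1
    simpa only [map_sum, map_smul, ← Module.End.mul_apply, ← pow_add, Polynomial.sum] using h1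
  have hcoeff : ∀ ψ : ℕ → L[X], (∀ j, (ψ j).natDegree ≤ j) →
      (q.sum fun n d => d • ψ n).coeff q.natDegree = (ψ q.natDegree).coeff q.natDegree :=
    fun ψ hψ => by
    rw [Polynomial.sum, finsetSum_coeff, Finset.sum_eq_single q.natDegree]
    · rw [hq.coeff_natDegree, one_smul]
    · intro n hn hne
      have := le_natDegree_of_mem_supp n hn
      rw [coeff_smul, coeff_eq_zero_of_natDegree_lt ((hψ n).trans_lt (by omega)), smul_zero]
    · intro h
      rw [notMem_support_iff.1 h, zero_smul, coeff_zero]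
  -- Each φ j has coefficient 1 in degree j, so the coefficients of y to the power deg q on the two
  -- sides are c' and c.
  have hcc : c = c' := by
    have h1 := congrArg (fun f => coeff f q.natDegree) (hrel 0)
    simp only [zero_add, coeff_smul] at h1
    rw [hcoeff _ fun j => (D.realization_pow 𝓛 j).1,
      hcoeff _ fun j => (D'.realization_pow 𝓛 j).1] at h1
    simp only [(D.realization_pow 𝓛 _).2, (D'.realization_pow 𝓛 _).2] at h1
    rw [← Algebra.algebraMap_eq_smul_one, ← Algebra.algebraMap_eq_smul_one] at h1
    exact ((algebraMap k (L)).injective h1).symm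
  refine ⟨hcc, ?_⟩
  subst hcc
  set δ : ℕ → L := fun j => D.series 𝓛 ((D.η ^ j) D.i) - D'.series 𝓛 ((D'.η ^ j) D'.i)
    with hδ
  have hψs : ∀ j, φ (j + 1) - φ' (j + 1) = X * (φ j - φ' j) + C (δ j) := fun j => by
    rw [hφs, hφs', hδ, C_sub]; ring
  have hrel' : ∀ j, q.sum (fun n d => d • (φ (j + n) - φ' (j + n))) = 0 := fun j => by
    have h1 := smul_right_injective _ hc (hrel j)
    simp only [Polynomial.sum, smul_sub, Finset.sum_sub_distrib] at h1 ⊢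
    rw [h1, sub_self]
  -- Once φ j = φ' j, the later differences at j + 1 + n have coefficient δ j in degree n and no
  -- higher terms. As q is monic, the relation at j + 1 read in degree deg q says δ j = 0.
  have hδ0 : ∀ j, φ j - φ' j = 0 → δ j = 0 := fun j hj => by
    have h1 : ∀ n, (φ (j + 1 + n) - φ' (j + 1 + n)).natDegree ≤ n ∧
        (φ (j + 1 + n) - φ' (j + 1 + n)).coeff n = δ j := fun n => by
      induction n with
      | zero => rw [add_zero, hψs, hj, mul_zero, zero_add]; simp
      | succ n ih =>
        rw [← add_assoc, hψs]
        constructor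
        · refine natDegree_add_le_of_degree_le
            ((natDegree_mul_le_of_le natDegree_X_le ih.1).trans (by omega)) (by simp)
        · rw [coeff_add, coeff_X_mul, ih.2, coeff_C_succ, add_zero]
    have h2 := hcoeff (fun n => φ (j + 1 + n) - φ' (j + 1 + n)) fun n => (h1 n).1
    rw [hrel', (h1 _).2, coeff_zero] at h2
    exact h2.symm
  have hψ0 : ∀ j, φ j - φ' j = 0 := fun j => by
    induction j with
    | zero => simp [hφ, hφ', realization_i]
    | succ j ih => rw [hψs, ih, hδ0 j ih, mul_zero, C_0, add_zero]
  intro n j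
  exact congrFun (𝓛.tail_injective (sub_eq_zero.1 (hδ0 j (hψ0 j)))) n

end IsLattice

/-- Two embeddings of the same module as a lattice differ by an isomorphism of cyclic pairs. -/
theorem IsLattice.exists_equiv {D : CyclicPair k E} {D' : CyclicPair k E'} {a b : Module.End k M}
    {r : M →ₗ[k] E} {r' : M →ₗ[k] E'} (hr : D.IsLattice a b r) (hr' : D'.IsLattice a b r')
    (hε : D.ε = D'.ε) :
    ∃ f : E ≃ₗ[k] E', (∀ u, f (D.ξ u) = D'.ξ (f u)) ∧ (∀ u, f (D.η u) = D'.η (f u)) ∧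
      ∀ m, f (r m) = r' m := by
  obtain ⟨p, hp, hpr, hpr'⟩ := hr.exists_monic hr'
  obtain ⟨q, hq, hqr, hqr'⟩ := hr.swap.exists_monic hr'.swap
  obtain ⟨h, hh⟩ := hpr D.i
  obtain ⟨h', hh'⟩ := hpr' D'.i
  obtain ⟨g, hg⟩ := hqr D.i
  obtain ⟨g', hg'⟩ := hqr' D'.i
  obtain ⟨c, hc, rfl⟩ := hr.exists_smul hr' hp hh hh'
  obtain ⟨c', hc', rfl⟩ := hr.swap.exists_smul hr'.swap hq hg hg'
  have hh1 : r' (c • h') = c • aeval D'.ξ p D'.i := by rw [map_smul, hh']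
  have hg1 : r' (c' • g') = c' • aeval D'.η q D'.i := by rw [map_smul, hg']; rfl
  obtain ⟨rfl, -⟩ := moments_eq (TailRing.laurent k) hr hr' hε hp.ne_zero hh hc hh1 hq hg hg1
  -- The swapped pairs provide the moments l(ηⁿξʲi), which are the values of l on the basis that
  -- defines f.
  have hmom := (moments_eq (TailRing.laurent k) hr.swap hr'.swap (by simp [hε]) hq.ne_zero hg hc hg1
    hp hh hh1).2
  simp only [swap_l, swap_ξ, swap_η, swap_i, LinearMap.neg_apply, neg_inj] at hmom
  set f : E ≃ₗ[k] E' := (D.coord.trans D'.coord.symm).trans (LinearEquiv.smulOfNeZero k E' c hc)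
  have hfb : ∀ n (p : k[X]), f ((D.η ^ n) (aeval D.ξ p D.i)) =
      c • (D'.η ^ n) (aeval D'.ξ p D'.i) := fun n p => by
    change c • D'.coord.symm (D.coord _) = _
    congr 1
    rw [LinearEquiv.symm_apply_eq, coord_η_pow, coord_η_pow, coord_aeval, coord_aeval]
  have hfη : ∀ u, f (D.η u) = D'.η (f u) := fun u => by
    change c • D'.coord.symm (D.coord _) = D'.η (c • D'.coord.symm (D.coord _))
    rw [map_smul]
    congr 1
    rw [LinearEquiv.symm_apply_eq, coord_η, coord_η, LinearEquiv.apply_symm_apply]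
  -- With f i = c i', this is what makes f compatible with the rank one part of the commutator, and
  -- so with ξ.
  have hfl : ∀ u, D'.l (f u) = c • D.l u := fun u => by
    rw [← D.normalForm_coord u]
    generalize D.coord u = w
    induction w using Polynomial.induction_on' with
    | add p q hp hq => simp only [map_add, hp, hq, smul_add]
    | monomial n p =>
      rw [normalForm_monomial, hfb, map_smul]
      congr 1
      induction p using Polynomial.induction_on' with
      | add p q hp hq => simp only [map_add, LinearMap.add_apply, hp, hq]
      | monomial m d =>
        simp only [aeval_monomial, Module.End.mul_apply, Module.algebraMap_end_apply, map_smul]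
        rw [hmom]
  have hfi : f D.i = c • D'.i := by simpa using hfb 0 1
  have hfξ : ∀ u, f (D.ξ u) = D'.ξ (f u) := fun u => by
    induction u using D.induction with
    | add u v hu hv => simp only [map_add, hu, hv]
    | base p =>
      have h1 := hfb 0 p
      have h2 := hfb 0 (X * p)
      simp only [pow_zero, Module.End.one_apply] at h1 h2
      rw [ξ_aeval, h2, h1, map_smul, ξ_aeval]
    | step u hu =>
      rw [ξ_η, map_add, map_sub, hfη, hu, hfη, ξ_η, map_smul, map_smul, hfi, hfl, hε, smul_smul,
        smul_eq_mul, mul_comm]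
  refine ⟨f, hfξ, hfη, fun m => sub_eq_zero.1 ?_⟩
  refine hr.eq_zero_of_intertwining hh (s := D'.ξ) (t := D'.η) (F := f.toLinearMap ∘ₗ r - r')
    (fun w hw => D'.eq_zero_of_aeval hp.ne_zero hw) (fun m => ?_) (fun m => ?_) ?_ m
  · simp [hr.map_ξ, hr'.map_ξ, hfξ]
  · simp [hr.map_η, hr'.map_η, hfη]
  · have h1 := hfb 0 p
    simp only [pow_zero, Module.End.one_apply] at h1
    rw [LinearMap.sub_apply, LinearMap.comp_apply, LinearEquiv.coe_coe, hh, h1, hh1, sub_self]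

/-- Some p(ξ) maps all of E into M, where f and g agree, and p(ξ') is injective on the target. -/
theorem IsLattice.hom_ext {D : CyclicPair k E} {D' : CyclicPair k E'} {a b : Module.End k M}
    {r : M →ₗ[k] E} (hr : D.IsLattice a b r) {f g : E →ₗ[k] E'}
    (hf : ∀ u, f (D.ξ u) = D'.ξ (f u)) (hg : ∀ u, g (D.ξ u) = D'.ξ (g u))
    (h : ∀ m, f (r m) = g (r m)) : f = g := by
  obtain ⟨p, hp, hpr, -⟩ := hr.exists_monic hr
  ext u
  obtain ⟨m, hm⟩ := hpr u
  refine sub_eq_zero.1 (D'.eq_zero_of_aeval hp.ne_zero ?_)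
  rw [map_sub, ← map_aeval_of_intertwining hf, ← map_aeval_of_intertwining hg, ← hm, h, sub_self]

end CyclicPair

/-! ## The standard basis of the first Weyl algebra -/

namespace WeylAlgebra

variable {k : Type*} [Field k]

theorem x_mul_y : x k * y k = y k * x k + 1 := by
  have h := RingQuot.mkAlgHom_rel k (WeylRel.comm (k := k))
  simp only [map_add, map_mul, map_one] at h
  exact h

theorem adjoin_eq_top : Algebra.adjoin k {x k, y k} = ⊤ := by
  rw [eq_top_iff]
  rintro a -
  obtain ⟨a, rfl⟩ := RingQuot.mkAlgHom_surjective k (WeylRel k) a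
  induction a using FreeAlgebra.induction with
  | grade0 c => rw [AlgHom.commutes]; exact Subalgebra.algebraMap_mem _ c
  | grade1 j =>
    apply Algebra.subset_adjoin
    fin_cases j
    · exact Or.inl rfl
    · exact Or.inr rfl
  | mul a b ha hb => rw [map_mul]; exact Subalgebra.mul_mem _ ha hb
  | add a b ha hb => rw [map_add]; exact Subalgebra.add_mem _ ha hb

/-- A right multiple of a subspace that is stable under `x` and `y`. -/
theorem mul_mem_of_stable {W : Submodule k (WeylAlgebra k)} (hx : ∀ w ∈ W, x k * w ∈ W)
    (hy : ∀ w ∈ W, y k * w ∈ W) (a : WeylAlgebra k) {w : WeylAlgebra k} (hw : w ∈ W) :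
    a * w ∈ W := by
  have ha : a ∈ Algebra.adjoin k {x k, y k} := by rw [adjoin_eq_top]; trivial
  induction ha using Algebra.adjoin_induction generalizing w with
  | mem z hz =>
    rcases hz with rfl | rfl
    · exact hx w hw
    · exact hy w hw
  | algebraMap c => rw [← Algebra.smul_def]; exact W.smul_mem c hw
  | add a b _ _ ha hb => rw [add_mul]; exact W.add_mem (ha hw) (hb hw)
  | mul a b _ _ ha hb => rw [mul_assoc]; exact ha (hb hw)

theorem y_mul_aeval (p : k[X]) :
    y k * aeval (x k) p = aeval (x k) p * y k - aeval (x k) (derivative p) := by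
  induction p using Polynomial.induction_on with
  | C c => rw [aeval_C, derivative_C, map_zero, sub_zero, Algebra.commutes]
  | add p q hp hq => rw [map_add, map_add, map_add, mul_add, add_mul, hp, hq]; abel
  | monomial n c h =>
    rw [pow_succ, ← mul_assoc]
    generalize C c * X ^ n = q at h ⊢
    rw [derivative_mul, derivative_X, mul_one, map_mul, map_add, map_mul, aeval_X, ← mul_assoc, h,
      mul_assoc _ (x k) (y k), x_mul_y]
    noncomm_ring
    rw [smul_mul_assoc]

/-- The map `∑ p_b(x) y^b ↦ ∑ p_b(x) y^b` from commutative polynomials to the Weyl algebra. -/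
noncomputable def ofPoly (k : Type*) [Field k] : k[X][X] →ₗ[k] WeylAlgebra k :=
  normalForm (LinearMap.mulLeft k (x k)) (LinearMap.mulRight k (y k)) 1

theorem ofPoly_monomial (b : ℕ) (p : k[X]) :
    ofPoly k (monomial b p) = aeval (x k) p * y k ^ b := by
  have h1 : aeval (LinearMap.mulLeft k (x k)) p = LinearMap.mulLeft k (aeval (x k) p) :=
    aeval_algHom_apply (Algebra.lmul k (WeylAlgebra k)) (x k) p
  rw [ofPoly, normalForm_monomial, LinearMap.pow_mulRight, LinearMap.mulRight_apply, h1,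
    LinearMap.mulLeft_apply, mul_one]

theorem ofPoly_surjective : Function.Surjective (ofPoly k) := by
  intro a
  have h1 : (1 : WeylAlgebra k) ∈ LinearMap.range (ofPoly k) :=
    ⟨monomial 0 1, by rw [ofPoly_monomial, map_one, pow_zero, mul_one]⟩
  have := mul_mem_of_stable (W := LinearMap.range (ofPoly k)) ?_ ?_ a h1
  · rwa [mul_one] at this
  · rintro _ ⟨f, rfl⟩
    induction f using Polynomial.induction_on' with
    | add p q hp hq => rw [map_add, mul_add]; exact Submodule.add_mem _ hp hq
    | monomial b p =>
      refine ⟨monomial b (X * p), ?_⟩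
      rw [ofPoly_monomial, ofPoly_monomial, map_mul, aeval_X, mul_assoc]
  · rintro _ ⟨f, rfl⟩
    induction f using Polynomial.induction_on' with
    | add p q hp hq => rw [map_add, mul_add]; exact Submodule.add_mem _ hp hq
    | monomial b p =>
      refine ⟨monomial (b + 1) p - monomial b (derivative p), ?_⟩
      rw [map_sub, ofPoly_monomial, ofPoly_monomial, ofPoly_monomial, ← mul_assoc, y_mul_aeval,
        sub_mul, pow_succ', mul_assoc]

/-- The derivative with respect to the inner variable. -/
noncomputable def innerDerivative (k : Type*) [Field k] : Module.End k k[X][X] :=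
  lsum fun n => (monomial n).restrictScalars k ∘ₗ derivative

theorem innerDerivative_monomial (n : ℕ) (p : k[X]) :
    innerDerivative k (monomial n p) = monomial n (derivative p) := by
  rw [innerDerivative, lsum_apply, sum_monomial_index] <;> simp

theorem innerDerivative_C_mul (f : k[X][X]) :
    innerDerivative k (C X * f) = f + C X * innerDerivative k f := by
  induction f using Polynomial.induction_on' with
  | add p q hp hq => rw [mul_add, map_add, map_add, hp, hq]; ring
  | monomial n p =>
    rw [C_mul_monomial, innerDerivative_monomial, innerDerivative_monomial, derivative_mul,
      derivative_X, one_mul, C_mul_monomial, map_add]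

/-- The operators of the representation on polynomials by `x` and `y - ∂/∂x`. -/
noncomputable def polyRepFun (k : Type*) [Field k] : Fin 2 → Module.End k k[X][X] :=
  ![LinearMap.mulLeft k (C X), LinearMap.mulLeft k X - innerDerivative k]

/-- The representation of the Weyl algebra on polynomials by `x` and `y - ∂/∂x`. -/
noncomputable def polyRep (k : Type*) [Field k] : WeylAlgebra k →ₐ[k] Module.End k k[X][X] :=
  RingQuot.liftAlgHom k ⟨FreeAlgebra.lift k (polyRepFun k), by
    rintro _ _ ⟨⟩
    ext1 f
    simp only [map_add, map_mul, map_one, FreeAlgebra.lift_ι_apply, polyRepFun,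
      Matrix.cons_val_zero, Matrix.cons_val_one, Module.End.mul_apply, LinearMap.add_apply,
      LinearMap.sub_apply, LinearMap.mulLeft_apply, Module.End.one_apply, innerDerivative_C_mul]
    ring⟩

theorem polyRep_x (f : k[X][X]) : polyRep k (x k) f = C X * f := by
  rw [polyRep, x, RingQuot.liftAlgHom_mkAlgHom_apply, FreeAlgebra.lift_ι_apply]
  rfl

theorem polyRep_y (f : k[X][X]) : polyRep k (y k) f = X * f - innerDerivative k f := by
  rw [polyRep, y, RingQuot.liftAlgHom_mkAlgHom_apply, FreeAlgebra.lift_ι_apply]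
  rfl

/-- Applied to 1, yᵇ gives the monomial yᵇ because the derivative in x vanishes there, and left
factors in x then only multiply. Thus evaluation at 1 recovers the normal form, which proves the
independence of the xᵃyᵇ. -/
theorem polyRep_ofPoly (f : k[X][X]) : polyRep k (ofPoly k f) 1 = f := by
  induction f using Polynomial.induction_on' with
  | add p q hp hq => rw [map_add, map_add, LinearMap.add_apply, hp, hq]
  | monomial b p =>
    have h1 : (polyRep k (y k) ^ b) 1 = monomial b 1 := by
      induction b with
      | zero => rfl
      | succ b ih =>
        rw [pow_succ', Module.End.mul_apply, ih, polyRep_y, innerDerivative_monomial,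
          derivative_one, map_zero, sub_zero, X_mul_monomial]
    rw [ofPoly_monomial, map_mul, map_pow, Module.End.mul_apply, h1, ← aeval_algHom_apply]
    induction p using Polynomial.induction_on' with
    | add p q hp hq => rw [map_add, LinearMap.add_apply, hp, hq, ← map_add]
    | monomial n c =>
      rw [aeval_monomial, Module.End.mul_apply, Module.algebraMap_end_apply]
      have h2 : (polyRep k (x k) ^ n) (monomial b 1) = monomial b (X ^ n) := by
        induction n with
        | zero => simp
        | succ n ih =>
          rw [pow_succ', Module.End.mul_apply, ih, polyRep_x, C_mul_monomial, ← pow_succ']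
      rw [h2, smul_monomial, smul_eq_C_mul, C_mul_X_pow_eq_monomial]

theorem ofPoly_bijective : Function.Bijective (ofPoly k) :=
  ⟨Function.LeftInverse.injective (g := fun a => polyRep k a 1) polyRep_ofPoly, ofPoly_surjective⟩

end WeylAlgebra

/-! ## Strict morphisms of A∞-modules -/

section Strict

open AInf Finset

variable {k : Type*} {A : Type*} {K : Type*} {L : Type*} {P : Type*} [Field k] [Ring A]
  [Algebra k A] [AddCommGroup K] [Module k K] [AddCommGroup L] [Module k L]
  [AddCommGroup P] [Module k P]

namespace AInfModule

/-- The bilinear map `m₂`. -/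
def act (S : AInfModule k A K) : K →ₗ[k] A →ₗ[k] K :=
  LinearMap.mk₂ k (fun u a => S.m 1 u fun _ => a)
    (fun u v a => by rw [map_add, _root_.add_apply])
    (fun c u a => by rw [map_smul, _root_.smul_apply])
    (fun u a b => by
      have h := (S.m 1 u).map_update_add (fun _ => 0) 0 a b
      simp only [Function.update_eq_const_of_subsingleton] at h
      exact h)
    (fun c u a => by
      have h := (S.m 1 u).map_update_smul (fun _ => 0) 0 c a
      simp only [Function.update_eq_const_of_subsingleton] at h
      exact h)

theorem m_one_eq (S : AInfModule k A K) (u : K) (a : Fin 1 → A) : S.m 1 u a = S.act u (a 0) :=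
  congrArg (S.m 1 u) (funext fun j => by rw [Subsingleton.elim j 0])

theorem act_mem (S : AInfModule k A K) {p : ℤ} {u : K} (hu : u ∈ S.deg p) (a : A) :
    S.act u a ∈ S.deg p := by
  have h := S.m_mem 1 p u hu fun _ => a
  rwa [Nat.cast_one, add_sub_cancel_right] at h

theorem d_mem (S : AInfModule k A K) {p : ℤ} {u : K} (hu : u ∈ S.deg p) :
    S.d u ∈ S.deg (p + 1) := by
  rw [S.d_apply u Fin.elim0]
  simpa using S.m_mem 0 p u hu Fin.elim0

theorem act_one (S : AInfModule k A K) (u : K) : S.act u 1 = u := S.m_one u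

theorem d_act (S : AInfModule k A K) (u : K) (a : A) : S.d (S.act u a) = S.act (S.d u) a := by
  have h := S.rel 1 u fun _ => a
  rw [Nat.sum_antidiagonal_eq_sum_range_succ_mk] at h
  simp only [sum_range_succ, Nat.sub_self, range_zero, sum_empty, zero_add, ev] at h
  change (-1 : k) ^ 1 • S.m 1 (S.m 0 u _) (fun _ => a) + (-1 : k) ^ 0 • S.m 0 (S.act u a) _ = 0 at h
  rw [← S.d_apply, ← S.d_apply, m_one_eq, pow_one, pow_zero, neg_smul, one_smul, one_smul,
    neg_add_eq_zero] at h
  exact h.symm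

/-- The relation with two letters: m₂ is associative up to the homotopy m₃. -/
theorem act_act (S : AInfModule k A K) (u : K) (a b : A) :
    S.act (S.act u a) b = S.act u (a * b) + S.m 2 (S.d u) ![a, b] + S.d (S.m 2 u ![a, b]) := by
  set w : ℕ → A := fun n => if n = 0 then a else b with hw
  have h := S.rel 2 u w
  have e₁ : (fun n : Fin 2 => w n) = ![a, b] := by
    funext n; fin_cases n <;> rfl
  have e₂ : (fun n : Fin 2 => shift 0 w n) = ![a, b] := by
    funext n; fin_cases n <;> rfl
  have e₃ : (fun n : Fin 1 => w n) = fun _ => a := by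
    funext n; fin_cases n; rfl
  have e₄ : (fun n : Fin 1 => shift 1 w n) = fun _ => b := by
    funext n; fin_cases n; rfl
  have e₅ : (fun n : Fin 1 => AInf.contract 0 w n) = fun _ => a * b := by
    funext n; fin_cases n; rfl
  rw [Nat.sum_antidiagonal_eq_sum_range_succ_mk] at h
  simp only [sum_range_succ, Nat.reduceSub, ev, range_one, sum_singleton, e₁, e₂, e₃, e₄, e₅] at h
  change (-1 : k) ^ 2 • S.act u (a * b) + ((-1 : k) ^ 2 • S.m 2 (S.m 0 u _) ![a, b] +
    (-1 : k) ^ 1 • S.act (S.act u a) b + (-1 : k) ^ 0 • S.m 0 (S.m 2 u ![a, b]) _) = 0 at h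
  rw [← S.d_apply, ← S.d_apply, even_two.neg_one_pow, pow_one, pow_zero, neg_smul, one_smul,
    one_smul, one_smul, one_smul] at h
  rw [← sub_eq_zero, ← neg_eq_zero, ← h]
  abel

end AInfModule

namespace AInfHom

variable {S : AInfModule k A K} {T : AInfModule k A L} {U : AInfModule k A P}

theorem eq_of_components {f g : AInfHom S T} (h : f.f = g.f) : f = g := by
  cases f
  cases g
  cases h
  rfl

theorem IsStrict.ext {f g : AInfHom S T} (hf : f.IsStrict) (hg : g.IsStrict)
    (h : ∀ u, f.first u = g.first u) : f = g := by
  refine eq_of_components (funext fun n => ?_)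
  cases n with
  | zero =>
    ext u a
    rw [← first_apply, ← first_apply, h]
  | succ n => rw [hf _ n.succ_pos, hg _ n.succ_pos]

theorem IsStrict.first_m {f : AInfHom S T} (hf : f.IsStrict) (N : ℕ) (u : K) (a : Fin N → A) :
    f.first (S.m N u a) = T.m N (f.first u) a := by
  -- The relations are stated for infinite sequences; the padding by 0 is never read.
  have h := f.rel N u fun n => if h : n < N then a ⟨n, h⟩ else 0
  rw [sum_eq_zero, sum_eq_single (N, 0), sum_eq_single (0, N)] at h
  · simpa [ev, shift, ← first_apply] using h
  · rintro ⟨p, q⟩ hpq hne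
    rw [HasAntidiagonal.mem_antidiagonal] at hpq
    dsimp only at hpq ⊢
    rw [hf p (Nat.pos_of_ne_zero ?_)]
    · simp [ev]
    · rintro rfl
      exact hne (by rw [← hpq, zero_add])
  · simp
  · rintro ⟨p, q⟩ hpq hne
    rw [HasAntidiagonal.mem_antidiagonal] at hpq
    dsimp only at hpq ⊢
    rw [hf q (Nat.pos_of_ne_zero ?_)]
    · simp [ev]
    · rintro rfl
      exact hne (by rw [← hpq, add_zero])
  · simp
  · intro i hi
    rw [mem_range] at hi
    rw [hf (N - 1) (by omega)]
    simp [ev]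

theorem IsStrict.first_act {f : AInfHom S T} (hf : f.IsStrict) (u : K) (a : A) :
    f.first (S.act u a) = T.act (f.first u) a :=
  hf.first_m 1 u _

theorem isStrict_id : (AInfHom.id S).IsStrict := fun n hn => by
  cases n with
  | zero => omega
  | succ n => rfl

theorem IsStrict.comp {g : AInfHom T U} {f : AInfHom S T} (hg : g.IsStrict) (hf : f.IsStrict) :
    (g.comp f).IsStrict := fun n hn => by
  ext u a
  change compFun g f n u a = 0
  simp only [compFun, LinearMap.sum_apply, _root_.sum_apply, plug_apply]
  refine sum_eq_zero fun p _ => ?_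
  by_cases hp : (p : ℕ) = 0
  · rw [hg (n - p) (by omega)]; rfl
  · rw [hf p (by omega)]; simp

theorem first_comp (g : AInfHom T U) (f : AInfHom S T) (u : K) :
    (g.comp f).first u = g.first (f.first u) := by
  rw [first_apply _ _ fun _ => 0]
  change compFun g f 0 u _ = _
  have h := ev_compFun g f 0 u fun _ => 0
  simp only [Nat.antidiagonal_zero, sum_singleton, ev, ← first_apply] at h
  exact h

theorem first_id (u : K) : (AInfHom.id S).first u = u := rfl

/-- A strict morphism, given by its first component. -/
def ofLinear (F : K →ₗ[k] L) (hdeg : ∀ p, ∀ u ∈ S.deg p, F u ∈ T.deg p)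
    (hm : ∀ (n : ℕ) (u : K) (a : Fin n → A), F (S.m n u a) = T.m n (F u) a) : AInfHom S T where
  f
    | 0 => (MultilinearMap.constLinearEquivOfIsEmpty (R := k) (S := k)
        (M₁ := fun _ : Fin 0 => A) (M₂ := L)).toLinearMap ∘ₗ F
    | _ + 1 => 0
  f_mem n p u hu a := by
    cases n with
    | zero => simpa using hdeg p u hu
    | succ n => simp
  rel N u a := by
    rw [sum_eq_zero, sum_eq_single (N, 0), sum_eq_single (0, N)]
    · simp [ev, shift, hm]
    · rintro ⟨p, q⟩ hpq hne
      rw [HasAntidiagonal.mem_antidiagonal] at hpq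
      cases p with
      | zero => exact absurd (by simpa using hpq) hne
      | succ p => simp [ev]
    · simp
    · rintro ⟨p, q⟩ hpq hne
      rw [HasAntidiagonal.mem_antidiagonal] at hpq
      cases q with
      | zero => exact absurd (by simpa using hpq) hne
      | succ q => simp [ev]
    · simp
    · intro i hi
      rw [mem_range] at hi
      obtain ⟨n, hn⟩ : ∃ n, N - 1 = n + 1 := ⟨N - 2, by omega⟩
      rw [hn]
      simp [ev]

theorem isStrict_ofLinear (F : K →ₗ[k] L) (hdeg : ∀ p, ∀ u ∈ S.deg p, F u ∈ T.deg p)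
    (hm : ∀ (n : ℕ) (u : K) (a : Fin n → A), F (S.m n u a) = T.m n (F u) a) :
    (ofLinear F hdeg hm).IsStrict := fun n hn => by
  cases n with
  | zero => omega
  | succ n => rfl

/-- A strict morphism whose first component is bijective is an isomorphism. -/
theorem exists_strict_isIso (F : K ≃ₗ[k] L) (hdeg : ∀ p u, F u ∈ T.deg p ↔ u ∈ S.deg p)
    (hm : ∀ (n : ℕ) (u : K) (a : Fin n → A), F (S.m n u a) = T.m n (F u) a) :
    ∃ f : AInfHom S T, f.IsStrict ∧ f.IsIso ∧ ∀ u, f.first u = F u := by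
  have hs := isStrict_ofLinear (S := S) (T := T) F.toLinearMap (fun p u => (hdeg p u).2) hm
  have hdeg' : ∀ p, ∀ u ∈ T.deg p, F.symm u ∈ S.deg p := fun p u hu => by
    rw [← hdeg, F.apply_symm_apply]; exact hu
  have hm' : ∀ (n : ℕ) (u : L) (a : Fin n → A), F.symm (T.m n u a) = S.m n (F.symm u) a :=
    fun n u a => by rw [LinearEquiv.symm_apply_eq, hm, F.apply_symm_apply]
  have hs' := isStrict_ofLinear (S := T) (T := S) F.symm.toLinearMap hdeg' hm'
  refine ⟨_, hs, ⟨_, (hs'.comp hs).ext isStrict_id fun u => ?_,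
    (hs.comp hs').ext isStrict_id fun u => ?_⟩, fun u => rfl⟩
  · rw [first_comp, first_id]
    exact F.symm_apply_apply u
  · rw [first_comp, first_id]
    exact F.apply_symm_apply u

end AInfHom

end Strict

/-! ## A∞-modules in degrees zero and one -/

section TwoTerm

variable {k : Type*} {A : Type*} {K : Type*} [Field k] [Ring A]
  [Algebra k A] [AddCommGroup K] [Module k K]

namespace AInfModule

/-- The A∞-module is concentrated in degrees `0` and `1`. -/
def IsTwoTerm (S : AInfModule k A K) : Prop := ∀ p : ℤ, p ≠ 0 → p ≠ 1 → S.deg p = ⊥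

namespace IsTwoTerm

variable {S : AInfModule k A K}

theorem m_eq_zero_of_deg_zero (hS : S.IsTwoTerm) {u : K} (hu : u ∈ S.deg 0) {n : ℕ} (hn : 2 ≤ n)
    (a : Fin n → A) : S.m n u a = 0 := by
  have h := S.m_mem n 0 u hu a
  rwa [hS _ (by omega) (by omega), Submodule.mem_bot] at h

theorem m_eq_zero_of_deg_one (hS : S.IsTwoTerm) {u : K} (hu : u ∈ S.deg 1) {n : ℕ} (hn : 3 ≤ n)
    (a : Fin n → A) : S.m n u a = 0 := by
  have h := S.m_mem n 1 u hu a
  rwa [hS _ (by omega) (by omega), Submodule.mem_bot] at h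

theorem d_eq_zero (hS : S.IsTwoTerm) {u : K} (hu : u ∈ S.deg 1) : S.d u = 0 := by
  have h := S.d_mem hu
  rwa [hS _ (by omega) (by omega), Submodule.mem_bot] at h

theorem isCompl (hS : S.IsTwoTerm) : IsCompl (S.deg 0) (S.deg 1) := by
  obtain ⟨h1, h2⟩ :=
    (DirectSum.isInternal_submodule_iff_iSupIndep_and_iSup_eq_top S.deg).1 S.isInternal
  refine ⟨h1.pairwiseDisjoint zero_ne_one, codisjoint_iff.2 (eq_top_iff.2 ?_)⟩
  rw [← h2]
  refine iSup_le fun p => ?_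
  by_cases h0 : p = 0
  · subst h0; exact le_sup_left
  by_cases h1 : p = 1
  · subst h1; exact le_sup_right
  rw [hS p h0 h1]
  exact bot_le

/-- Read backwards, this expresses m₃ on coboundaries by the failure of associativity in degree
zero. -/
theorem act_act (hS : S.IsTwoTerm) {u : K} (hu : u ∈ S.deg 0) (a b : A) :
    S.act (S.act u a) b = S.act u (a * b) + S.m 2 (S.d u) ![a, b] := by
  rw [AInfModule.act_act, hS.m_eq_zero_of_deg_zero hu le_rfl, map_zero, add_zero]

end IsTwoTerm

/-- The operation of a fixed element of the algebra on the component of degree zero. -/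
def actZero (S : AInfModule k A K) (a : A) : Module.End k (S.deg 0) :=
  (S.act.flip a).restrict fun _ hu => S.act_mem hu a

theorem coe_actZero (S : AInfModule k A K) (a : A) (u : S.deg 0) :
    (S.actZero a u : K) = S.act u a := rfl

/-- The differential from degree zero to degree one. -/
def dZero (S : AInfModule k A K) : S.deg 0 →ₗ[k] S.deg 1 :=
  S.d.restrict fun _ hu => S.d_mem hu

theorem coe_dZero (S : AInfModule k A K) (u : S.deg 0) : (S.dZero u : K) = S.d u := rfl

end AInfModule

end TwoTerm

/-! ## Envelopes as cyclic pairs -/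

section Envelope

open WeylAlgebra AInfModule

variable {k : Type*} [Field k] {M : Type*} [AddCommGroup M] [Module k M]
  [Module (WeylAlgebra k)ᵐᵒᵖ M] [IsScalarTower k (WeylAlgebra k)ᵐᵒᵖ M]
  {K : Type*} [AddCommGroup K] [Module k K] {S : AInfModule k (WeylAlgebra k) K}
  {K' : Type*} [AddCommGroup K'] [Module k K'] {S' : AInfModule k (WeylAlgebra k) K'}
  {r : AInfHom (ofModule k (WeylAlgebra k) M) S}
  {r' : AInfHom (ofModule k (WeylAlgebra k) M) S'}

theorem mem_deg_zero_ofModule (m : M) : m ∈ (ofModule k (WeylAlgebra k) M).deg 0 := by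
  change m ∈ if (0 : ℤ) = 0 then (⊤ : Submodule k M) else ⊥
  rw [if_pos rfl]
  trivial

theorem deg_ofModule_eq_bot {p : ℤ} (hp : p ≠ 0) : (ofModule k (WeylAlgebra k) M).deg p = ⊥ :=
  if_neg hp

theorem d_ofModule (m : M) : (ofModule k (WeylAlgebra k) M).d m = 0 := rfl

/-- The embedding of the module in the component of degree zero. -/
def AInfHom.firstZero (r : AInfHom (ofModule k (WeylAlgebra k) M) S) : M →ₗ[k] S.deg 0 :=
  r.first.codRestrict _ fun m => r.first_mem (mem_deg_zero_ofModule m)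

theorem AInfHom.coe_firstZero (m : M) : (r.firstZero m : K) = r.first m := rfl

/-- The component with n letters from the algebra has degree -n, so for n ≥ 1 it lands in a negative
degree, where K vanishes. -/
theorem AInfHom.isStrict_of_isTwoTerm (hS : S.IsTwoTerm)
    (r : AInfHom (ofModule k (WeylAlgebra k) M) S) : r.IsStrict := fun n hn => by
  ext m a
  have h := r.f_mem n 0 m (mem_deg_zero_ofModule m) a
  rwa [hS _ (by omega) (by omega), Submodule.mem_bot] at h

/-- The value of the action of a polynomial in normal form. -/
theorem act_ofPoly {u : S.deg 0}
    (hx : ∀ (u : S.deg 0) (a : WeylAlgebra k), S.act (S.act u (x k)) a = S.act u (x k * a))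
    (hy : ∀ (u : S.deg 0) (a : WeylAlgebra k), S.act (S.act u a) (y k) = S.act u (a * y k))
    (f : k[X][X]) :
    (normalForm (S.actZero (x k)) (S.actZero (y k)) u f : K) = S.act u (ofPoly k f) := by
  induction f using Polynomial.induction_on' with
  | add p q hp hq => simp only [map_add, Submodule.coe_add, hp, hq]
  | monomial b p =>
    rw [normalForm_monomial, ofPoly_monomial]
    induction b with
    | zero =>
      rw [pow_zero, pow_zero, mul_one, Module.End.one_apply]
      induction p using Polynomial.induction_on' with
      | add p q hp hq => simp only [map_add, LinearMap.add_apply, Submodule.coe_add, hp, hq]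
      | monomial n c =>
        rw [aeval_monomial, Module.End.mul_apply, Module.algebraMap_end_apply, aeval_monomial,
          ← Algebra.smul_def, map_smul, Submodule.coe_smul]
        congr 1
        induction n generalizing u with
        | zero => rw [pow_zero, pow_zero, act_one, Module.End.one_apply]
        | succ n ih =>
          rw [pow_succ, Module.End.mul_apply, ih, coe_actZero, hx, ← pow_succ']
    | succ b ih =>
      rw [pow_succ', Module.End.mul_apply, coe_actZero, ih, hy, mul_assoc, ← pow_succ]

namespace IsEnvelope

theorem isTwoTerm (hr : IsEnvelope r) : S.IsTwoTerm := hr.two_term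

theorem firstZero_injective (hr : IsEnvelope r) : Function.Injective r.firstZero := by
  rw [injective_iff_map_eq_zero]
  intro m hm
  have hm' : r.first m = 0 := congrArg Subtype.val hm
  have hc : m ∈ (ofModule k (WeylAlgebra k) M).cocycles 0 :=
    ⟨mem_deg_zero_ofModule m, LinearMap.mem_ker.2 (d_ofModule m)⟩
  have h1 : r.cohomologyMap 0 (Submodule.Quotient.mk ⟨m, hc⟩) = 0 := by
    rw [AInfHom.cohomologyMap, Submodule.mapQ_apply, Submodule.Quotient.mk_eq_zero]
    exact ⟨0, Submodule.zero_mem _, by simpa using hm'.symm⟩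
  have h2 := (hr.quasiIso 0).1 (h1.trans (map_zero _).symm)
  rw [Submodule.Quotient.mk_eq_zero] at h2
  obtain ⟨z, hz, hzm⟩ := h2
  exact hzm.symm.trans (d_ofModule z)

/-- K has no component of degree -1, so its cohomology in degree 0 is the kernel of d itself. -/
theorem range_firstZero (hr : IsEnvelope r) :
    LinearMap.range r.firstZero = LinearMap.ker S.dZero := by
  ext u
  rw [LinearMap.mem_ker]
  constructor
  · rintro ⟨m, rfl⟩
    apply Subtype.ext
    rw [coe_dZero, AInfHom.coe_firstZero, ← r.first_d, d_ofModule, map_zero, Submodule.coe_zero]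
  · intro hu
    have hc : (u : K) ∈ S.cocycles 0 := ⟨u.2, LinearMap.mem_ker.2 (congrArg Subtype.val hu)⟩
    obtain ⟨z, hz⟩ := (hr.quasiIso 0).2 (Submodule.Quotient.mk ⟨u, hc⟩)
    obtain ⟨⟨m, hm⟩, rfl⟩ := Submodule.Quotient.mk_surjective _ z
    rw [AInfHom.cohomologyMap, Submodule.mapQ_apply, Submodule.Quotient.eq] at hz
    obtain ⟨w, hw, hwu⟩ := hz
    rw [SetLike.mem_coe, hr.isTwoTerm _ (by norm_num) (by norm_num), Submodule.mem_bot] at hw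
    rw [hw, map_zero] at hwu
    exact ⟨m, Subtype.ext (sub_eq_zero.1 hwu.symm)⟩

/-- All of K¹ consists of cocycles, and its cohomology vanishes because M has none in degree 1. -/
theorem dZero_surjective (hr : IsEnvelope r) : Function.Surjective S.dZero := by
  intro v
  have hc : (v : K) ∈ S.cocycles 1 := ⟨v.2, LinearMap.mem_ker.2 (hr.isTwoTerm.d_eq_zero v.2)⟩
  obtain ⟨z, hz⟩ := (hr.quasiIso 1).2 (Submodule.Quotient.mk ⟨v, hc⟩)
  obtain ⟨⟨m, hm⟩, rfl⟩ := Submodule.Quotient.mk_surjective _ z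
  have hm0 : m ∈ (ofModule k (WeylAlgebra k) M).deg 1 := hm.1
  rw [deg_ofModule_eq_bot one_ne_zero, Submodule.mem_bot] at hm0
  rw [AInfHom.cohomologyMap, Submodule.mapQ_apply, Submodule.Quotient.eq] at hz
  obtain ⟨w, hw, hwv⟩ := hz
  have hw0 : w ∈ S.deg 0 := hw
  refine ⟨-⟨w, hw0⟩, Subtype.ext ?_⟩
  have h1 : S.d w = r.first m - v := hwv
  rw [map_neg, Submodule.coe_neg, coe_dZero, h1, hm0, map_zero, zero_sub, neg_neg]

theorem act_x_act (hr : IsEnvelope r) (u : S.deg 0) (a : WeylAlgebra k) :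
    S.act (S.act u (x k)) a = S.act u (x k * a) := by
  obtain ⟨i, -, -, h, -, -⟩ := hr.exists_cyclic
  rw [hr.isTwoTerm.act_act u.2, h _ (S.d_mem u.2), add_zero]

theorem act_act_y (hr : IsEnvelope r) (u : S.deg 0) (a : WeylAlgebra k) :
    S.act (S.act u a) (y k) = S.act u (a * y k) := by
  obtain ⟨i, -, -, -, h, -⟩ := hr.exists_cyclic
  rw [hr.isTwoTerm.act_act u.2, h _ (S.d_mem u.2), add_zero]

/-- The component of degree zero of an envelope is a cyclic pair, in which the module is a
lattice. -/
theorem exists_cyclicPair (hr : IsEnvelope r) :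
    ∃ D : CyclicPair k (S.deg 0), D.ξ = S.actZero (x k) ∧ D.η = S.actZero (y k) ∧ D.ε = 1 ∧
      D.IsLattice ((ofModule k (WeylAlgebra k) M).act.flip (x k))
        ((ofModule k (WeylAlgebra k) M).act.flip (y k)) r.firstZero := by
  obtain ⟨i, hi, hbij, hx, hy, hyx⟩ := hr.exists_cyclic
  set j : S.deg 0 := ⟨i, hi⟩
  have hact : ∀ a : WeylAlgebra k, S.m 1 i ![a] = S.act i a := fun a => S.m_one_eq i ![a]
  have hnf : ∀ f, (normalForm (S.actZero (x k)) (S.actZero (y k)) j f : K) =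
    S.m 1 i ![ofPoly k f] := fun f => by
    rw [hact]
    exact act_ofPoly hr.act_x_act hr.act_act_y f
  have hnfb : Function.Bijective (normalForm (S.actZero (x k)) (S.actZero (y k)) j) := by
    constructor
    · intro f g hfg
      have h := congrArg Subtype.val hfg
      rw [hnf, hnf] at h
      exact ofPoly_bijective.1 (hbij.injOn (Set.mem_univ _) (Set.mem_univ _) h)
    · intro u
      obtain ⟨a, -, ha⟩ := hbij.surjOn u.2
      obtain ⟨f, rfl⟩ := ofPoly_bijective.2 a
      exact ⟨f, Subtype.ext ((hnf f).trans ha)⟩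
  have hj : j ≠ 0 := by
    intro h
    have h1 : normalForm (S.actZero (x k)) (S.actZero (y k)) j 1 = 0 := by
      rw [← C_1, normalForm_C, map_one, Module.End.one_apply, h]
    exact one_ne_zero (hnfb.1 (h1.trans (map_zero _).symm))
  -- This operator is w ↦ m₃(dw, y, x), by the failure of associativity for (w, y, x) and xy = yx +
  -- 1. Its values lie on the line k i, whence the functional l.
  set T : Module.End k (S.deg 0) :=
    1 - S.actZero (y k) * S.actZero (x k) + S.actZero (x k) * S.actZero (y k)
  have hT : ∀ w : S.deg 0, (T w : K) = S.m 2 (S.d w) ![y k, x k] := fun w => by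
    have h1 : (T w : K) = w - S.act (S.act w (x k)) (y k) + S.act (S.act w (y k)) (x k) := rfl
    rw [h1, hr.act_x_act, hr.isTwoTerm.act_act w.2, x_mul_y, map_add, act_one]
    abel
  have hTm : ∀ w, T w ∈ Submodule.span k {j} := fun w => by
    obtain ⟨c, hc⟩ := Submodule.mem_span_singleton.1 (hyx _ (S.d_mem w.2))
    exact Submodule.mem_span_singleton.2 ⟨c, Subtype.ext (hc.trans (hT w).symm)⟩
  set l : S.deg 0 →ₗ[k] k :=
    (LinearEquiv.toSpanNonzeroSingleton k (S.deg 0) j hj).symm.toLinearMap ∘ₗ T.codRestrict _ hTm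
  have hl : ∀ w, l w • j = T w := fun w =>
    congrArg Subtype.val
      ((LinearEquiv.toSpanNonzeroSingleton k (S.deg 0) j hj).apply_symm_apply ⟨T w, hTm w⟩)
  have hstrict := r.isStrict_of_isTwoTerm hr.isTwoTerm
  refine ⟨⟨S.actZero (x k), S.actZero (y k), j, 1, l, fun w => ?_, hnfb⟩, rfl, rfl, rfl,
    hr.firstZero_injective, fun m => Subtype.ext (hstrict.first_act m (x k)),
    fun m => Subtype.ext (hstrict.first_act m (y k)), fun m => ?_, ?_⟩
  · rw [hl, one_smul]
    change _ = w - (w - S.actZero (y k) (S.actZero (x k) w) + S.actZero (x k) (S.actZero (y k) w))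
    abel
  · change l _ = 0
    have h1 : T (r.firstZero m) = 0 := Subtype.ext (by
      rw [hT, AInfHom.coe_firstZero, ← r.first_d, d_ofModule, map_zero, map_zero]
      rfl)
    exact (smul_eq_zero.1 ((hl _).trans h1)).resolve_right hj
  -- The quotient of K⁰ by M is K¹, which is finite-dimensional.
  · rw [hr.range_firstZero]
    have := hr.finite
    exact Module.Finite.equiv (S.dZero.quotKerEquivOfSurjective hr.dZero_surjective).symm

/-- The components of degree zero of two envelopes are isomorphic. -/
theorem exists_equiv_deg_zero (hr : IsEnvelope r) (hr' : IsEnvelope r') :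
    ∃ f : S.deg 0 ≃ₗ[k] S'.deg 0, (∀ u a, f (S.actZero a u) = S'.actZero a (f u)) ∧
      ∀ m, f (r.firstZero m) = r'.firstZero m := by
  obtain ⟨D, hξ, hη, hε, hD⟩ := hr.exists_cyclicPair
  obtain ⟨D', hξ', hη', hε', hD'⟩ := hr'.exists_cyclicPair
  obtain ⟨f, h1, h2, h3⟩ := hD.exists_equiv hD' (hε.trans hε'.symm)
  rw [hξ, hξ'] at h1
  rw [hη, hη'] at h2
  refine ⟨f, fun u a => ?_, h3⟩
  obtain ⟨g, rfl⟩ := ofPoly_surjective a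
  have h4 : f (normalForm (S.actZero (x k)) (S.actZero (y k)) u g) =
      normalForm (S'.actZero (x k)) (S'.actZero (y k)) (f u) g := by
    induction g using Polynomial.induction_on' with
    | add p q hp hq => rw [map_add, map_add, map_add, hp, hq]
    | monomial b p =>
      rw [normalForm_monomial, normalForm_monomial, ← LinearEquiv.coe_coe,
        map_pow_of_intertwining (r := f.toLinearMap) h2,
        map_aeval_of_intertwining (r := f.toLinearMap) h1]
  have h5 : S.actZero (ofPoly k g) u = normalForm (S.actZero (x k)) (S.actZero (y k)) u g :=
    Subtype.ext (act_ofPoly hr.act_x_act hr.act_act_y g).symm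
  have h6 : S'.actZero (ofPoly k g) (f u) =
      normalForm (S'.actZero (x k)) (S'.actZero (y k)) (f u) g :=
    Subtype.ext (act_ofPoly hr'.act_x_act hr'.act_act_y g).symm
  rw [h5, h6, h4]

/-- Two envelopes are isomorphic as complexes with operations. -/
theorem exists_equiv (hr : IsEnvelope r) (hr' : IsEnvelope r') :
    ∃ F : K ≃ₗ[k] K', (∀ p u, F u ∈ S'.deg p ↔ u ∈ S.deg p) ∧
      (∀ (n : ℕ) (u : K) (a : Fin n → WeylAlgebra k), F (S.m n u a) = S'.m n (F u) a) ∧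
      ∀ m, F (r.first m) = r'.first m := by
  obtain ⟨f, hfa, hfr⟩ := hr.exists_equiv_deg_zero hr'
  have hker : (LinearMap.ker S.dZero).map (f : S.deg 0 →ₗ[k] S'.deg 0) =
      LinearMap.ker S'.dZero := by
    rw [← hr.range_firstZero, ← hr'.range_firstZero, ← LinearMap.range_comp]
    congr 1
    ext1 m
    exact hfr m
  -- Since f matches the two copies of M, it induces an isomorphism of the quotients K⁰/M, which are
  -- the components of degree one.
  set g : S.deg 1 ≃ₗ[k] S'.deg 1 :=
    (S.dZero.quotKerEquivOfSurjective hr.dZero_surjective).symm.trans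
      ((Submodule.Quotient.equiv _ _ f hker).trans
        (S'.dZero.quotKerEquivOfSurjective hr'.dZero_surjective))
  have hg : ∀ u, g (S.dZero u) = S'.dZero (f u) := fun u => by
    have h1 : (S.dZero.quotKerEquivOfSurjective hr.dZero_surjective).symm (S.dZero u) =
        Submodule.Quotient.mk u := by
      rw [LinearEquiv.symm_apply_eq]
      rfl
    simp only [g, LinearEquiv.trans_apply]
    rw [h1]
    rfl
  set F : K ≃ₗ[k] K' := (Submodule.prodEquivOfIsCompl _ _ hr.isTwoTerm.isCompl).symm.trans
    ((f.prodCongr g).trans (Submodule.prodEquivOfIsCompl _ _ hr'.isTwoTerm.isCompl))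
  have hF0 : ∀ u : S.deg 0, F u = f u := fun u => by
    simp [F]
  have hF1 : ∀ u : S.deg 1, F u = g u := fun u => by
    simp [F]
  have hd : ∀ u : S.deg 0, F (S.d u) = S'.d (F u) := fun u => by
    rw [← coe_dZero, hF1, hg, coe_dZero, hF0]
  have hact : ∀ (u : S.deg 0) a, F (S.act u a) = S'.act (F u) a := fun u a => by
    rw [← coe_actZero, hF0, hfa, coe_actZero, hF0]
  refine ⟨F, fun p u => ?_, fun n u a => ?_, fun m => ?_⟩
  · by_cases h0 : p = 0
    · subst h0
      constructor
      · intro h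
        obtain ⟨v, hv⟩ := f.surjective ⟨F u, h⟩
        have h1 : F v = F u := by rw [hF0, hv]
        rw [← F.injective h1]
        exact v.2
      · intro h
        rw [hF0 ⟨u, h⟩]
        exact (f _).2
    by_cases h1 : p = 1
    · subst h1
      constructor
      · intro h
        obtain ⟨v, hv⟩ := g.surjective ⟨F u, h⟩
        have h1 : F v = F u := by rw [hF1, hv]
        rw [← F.injective h1]
        exact v.2
      · intro h
        rw [hF1 ⟨u, h⟩]
        exact (g _).2
    rw [hr.isTwoTerm p h0 h1, hr'.isTwoTerm p h0 h1, Submodule.mem_bot, Submodule.mem_bot,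
      LinearEquiv.map_eq_zero_iff]
  · obtain ⟨⟨v, w⟩, rfl⟩ := (Submodule.prodEquivOfIsCompl _ _ hr.isTwoTerm.isCompl).surjective u
    -- Every element of degree one is a coboundary dw, so its operations can be computed from w.
    obtain ⟨w, rfl⟩ := hr.dZero_surjective w
    have hFv : F v ∈ S'.deg 0 := by rw [hF0]; exact (f v).2
    have hFw : F w ∈ S'.deg 0 := by rw [hF0]; exact (f w).2
    have h0 : F (S.m n v a) = S'.m n (F v) a := by
      match n with
      | 0 => rw [← S.d_apply, ← S'.d_apply, hd]
      | 1 => rw [m_one_eq, m_one_eq, hact]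
      | n + 2 =>
        rw [hr.isTwoTerm.m_eq_zero_of_deg_zero v.2 (by omega),
          hr'.isTwoTerm.m_eq_zero_of_deg_zero hFv (by omega), map_zero]
    have h1 : F (S.m n (S.d w) a) = S'.m n (S'.d (F w)) a := by
      clear h0
      match n with
      | 0 =>
        rw [← S.d_apply, ← S'.d_apply, hr.isTwoTerm.d_eq_zero (S.d_mem w.2),
          hr'.isTwoTerm.d_eq_zero (S'.d_mem hFw), map_zero]
      | 1 =>
        rw [m_one_eq, m_one_eq, ← d_act, ← d_act, ← hact]
        exact hd (S.actZero (a 0) w)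
      | 2 =>
        obtain ⟨b, c, rfl⟩ : ∃ b c, a = ![b, c] := ⟨_, _, (FinVec.etaExpand_eq a).symm⟩
        -- m₃(dw, b, c) is (wb)c - w(bc), and F already respects the action in degree zero.
        have h2 := sub_eq_iff_eq_add'.2 (hr.isTwoTerm.act_act w.2 b c)
        have h3 := sub_eq_iff_eq_add'.2 (hr'.isTwoTerm.act_act hFw b c)
        have h4 : F (S.act (S.act w b) c) = S'.act (F (S.act w b)) c := hact (S.actZero b w) c
        rw [← h2, ← h3, map_sub, h4, hact, hact]
      | n + 3 =>
        rw [hr.isTwoTerm.m_eq_zero_of_deg_one (S.d_mem w.2) (by omega),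
          hr'.isTwoTerm.m_eq_zero_of_deg_one (S'.d_mem hFw) (by omega), map_zero]
    rw [Submodule.coe_prodEquivOfIsCompl', coe_dZero]
    simp only [map_add, _root_.add_apply, hd, h0, h1]
  · rw [← AInfHom.coe_firstZero, hF0, hfr, AInfHom.coe_firstZero]

/-- A strict morphism that is compatible with the embeddings of the module is unique. -/
theorem strict_unique (hr : IsEnvelope r) (hr' : IsEnvelope r') {f g : AInfHom S S'}
    (hf : f.IsStrict) (hg : g.IsStrict) (h : ∀ m, f.first (r.first m) = g.first (r.first m)) :
    f = g := by
  obtain ⟨D, hξ, -, -, hD⟩ := hr.exists_cyclicPair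
  obtain ⟨D', hξ', -, -, -⟩ := hr'.exists_cyclicPair
  have h0 : f.first.restrict (fun _ hu => f.first_mem hu) =
      (g.first.restrict (fun _ hu => g.first_mem hu) : S.deg 0 →ₗ[k] S'.deg 0) := by
    refine hD.hom_ext (D' := D') (fun u => ?_) (fun u => ?_) fun m => Subtype.ext (h m)
    · rw [hξ, hξ']; exact Subtype.ext (hf.first_act u (x k))
    · rw [hξ, hξ']; exact Subtype.ext (hg.first_act u (x k))
  have h1 : ∀ u : S.deg 0, f.first u = g.first u := fun u =>
    congrArg Subtype.val (LinearMap.congr_fun h0 u)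
  refine hf.ext hg fun u => ?_
  obtain ⟨⟨v, w⟩, rfl⟩ := (Submodule.prodEquivOfIsCompl _ _ hr.isTwoTerm.isCompl).surjective u
  obtain ⟨w, rfl⟩ := hr.dZero_surjective w
  rw [Submodule.coe_prodEquivOfIsCompl', coe_dZero, map_add, map_add, f.first_d, g.first_d, h1, h1]

end IsEnvelope

end Envelope

/-- An A∞-envelope of a finitely generated torsion-free right module `M` of rank `1` over the first
Weyl algebra is unique up to a unique strict isomorphism. -/
theorem corollary2 {k : Type u} [Field k] [IsAlgClosed k] [CharZero k]
    {M : Type v} [AddCommGroup M] [Module k M] [Module (WeylAlgebra k)ᵐᵒᵖ M]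
    [IsScalarTower k (WeylAlgebra k)ᵐᵒᵖ M]
    (hM : IsRankOneTorsionFree (WeylAlgebra k) M)
    {K : Type w} [AddCommGroup K] [Module k K] {S : AInfModule k (WeylAlgebra k) K}
    {K' : Type w'} [AddCommGroup K'] [Module k K'] {S' : AInfModule k (WeylAlgebra k) K'}
    (r : AInfHom (AInfModule.ofModule k (WeylAlgebra k) M) S) (hr : IsEnvelope r)
    (r' : AInfHom (AInfModule.ofModule k (WeylAlgebra k) M) S') (hr' : IsEnvelope r') :
    ∃! f : AInfHom S S', f.IsStrict ∧ f.IsIso ∧ r' = f.comp r := by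
  obtain ⟨F, hdeg, hm, hF⟩ := hr.exists_equiv hr'
  obtain ⟨f, hs, hi, hf⟩ := AInfHom.exists_strict_isIso F hdeg hm
  have hrs := r.isStrict_of_isTwoTerm hr.isTwoTerm
  refine ⟨f, ⟨hs, hi, (r'.isStrict_of_isTwoTerm hr'.isTwoTerm).ext (hs.comp hrs) fun m => ?_⟩, ?_⟩
  · rw [AInfHom.first_comp, hf, hF]
  · rintro g ⟨hg, -, hgr⟩
    refine hr.strict_unique hr' hg hs fun m => ?_
    rw [← AInfHom.first_comp, ← AInfHom.first_comp, ← hgr, AInfHom.first_comp, hf, hF]
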